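/- Let $\mathcal R=\mathbb C[x,y]$ and $[f,g]=\frac{\partial f}{\partial x}\frac{\partial g}{\partial y}-\frac{\partial g}{\partial x}\frac{\partial f}{\partial y}$ for $f,g\in\mathcal R$. For $f=\sum f_{ij}x^iy^j\in\mathcal R$ let $\operatorname{supp}(f)=\{(i,j): f_{ij}\neq 0\}\subset\mathbb R^2$, let the Newton polygon $N(f)$ be the convex hull of $\operatorname{supp}(f)$, and let $N^0(f)$ be the convex hull of $\operatorname{supp}(f)\cup\{(0,0)\}$ if $f\ne 0$, and $N^0(0)=\emptyset$. For $(u,v)\in\{(0,1),(1,1)\}$ let $f^{(u,v)}_k$ be the sum of the terms $f_{ij}x^iy^j$ of $f$ with $ui+vj=k$. Let $T_{m,n}=\{(x,y)\in\mathbb R^2: 0\le y\le n,\ 0\le x\le m+n-y\}$, and let $\mathcal Q$ be the set of $(a,b,m,n)\in\mathbb Z_{>0}^4$ with $m<n$, $a\mid m$, $a\mid n$, $\gcd(a,b)=1$ and $2\le a<b$. **Conjecture A.** Let $a,b$ be relatively prime positive integers with $2\le a<b$. Suppose that $F,G\in\mathcal R$ satisfy: (1) $[F,G]\in\mathbb C$;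 (2) $\{(0,0),(0,1),(1,0)\}\subset N(F)$, and $N(F)$ is similar to $N(G)$ with the origin as center of similarity and with ratio $\deg(F):\deg(G)=a:b$, that is, $N(G)=\frac ba N(F)$ and $b\deg(F)=a\deg(G)$. Then $[F,G]=0$. **Conjecture B.** Let $(a,b,m,n)\in\mathcal Q$. Suppose that $F,G\in\mathcal R$ satisfy: (1) $N^0(F)=T_{m,n}$ and $N^0(F-x^my^n)\subsetneq N^0(F)$; (2) $F^{(0,1)}_{n-i}$ is divisible by $(x+1)^{m-i}$ for $0\le i\le m$; (3) $F^{(1,1)}_{m+n-i}$ is divisible by $(x+y)^{n-i}$ for $0\le i\le n$; (4) $N^0(G)=T_{bm/a,\,bn/a}$ and $N^0(G-x^{bm/a}y^{bn/a})\subsetneq N^0(G)$; (5) $[F,G]\in\mathbb C$. Then $[F,G]=0$. **Lemma.** Conjecture B implies Conjecture A. -/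

import Mathlib

open MvPolynomial
open scoped Pointwise

noncomputable section

namespace JacobianTrapezoid

/-- The polynomial ring `ℂ[x, y]`; `x` is `X 0` and `y` is `X 1`. -/
abbrev Poly : Type := MvPolynomial (Fin 2) ℂ

/-- The Jacobian determinant `[f, g] = f_x g_y - g_x f_y`. -/
def bracket (f g : Poly) : Poly :=
  pderiv 0 f * pderiv 1 g - pderiv 0 g * pderiv 1 f

/-- The condition `[f, g] ∈ ℂ`. -/
def BracketConst (f g : Poly) : Prop :=
  ∃ c : ℂ, bracket f g = C c

/-- The support `{(i, j) : the coefficient of x^i y^j in f is nonzero}`, as a subset of `ℝ²`. -/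
def supp (f : Poly) : Set (ℝ × ℝ) :=
  {p | ∃ d ∈ f.support, p = ((d 0 : ℝ), (d 1 : ℝ))}

/-- The Newton polygon `N(f)`. -/
def newton (f : Poly) : Set (ℝ × ℝ) :=
  convexHull ℝ (supp f)

open Classical in
/-- The augmented Newton polygon `N⁰(f)`, with `N⁰(0) = ∅`. -/
def newton0 (f : Poly) : Set (ℝ × ℝ) :=
  if f = 0 then ∅ else convexHull ℝ (supp f ∪ {(0, 0)})

/-- The trapezoid `T_{m,n} = {(x, y) : 0 ≤ y ≤ n, 0 ≤ x ≤ m + n - y}`. -/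
def trapezoid (m n : ℝ) : Set (ℝ × ℝ) :=
  {p | (0 ≤ p.2 ∧ p.2 ≤ n) ∧ (0 ≤ p.1 ∧ p.1 ≤ m + n - p.2)}

/-- The component of `f` of degree `k` for the grading in which `x^i y^j` has degree
`u * i + v * j`. -/
def homComp (u v k : ℕ) (f : Poly) : Poly :=
  weightedHomogeneousComponent ![u, v] k f

/-- The index set `𝒬` of quadruples `(a, b, m, n)` of positive integers. -/
def IsQuadruple (a b m n : ℕ) : Prop :=
  0 < a ∧ 0 < b ∧ 0 < m ∧ 0 < n ∧
    m < n ∧ a ∣ m ∧ a ∣ n ∧ Nat.gcd a b = 1 ∧ 2 ≤ a ∧ a < b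

/-- Conjecture A. The polygon `N(G)` is the image of `N(F)` under the homothety with center
the origin and ratio `b / a`, and `deg F : deg G = a : b`. -/
def ConjectureA : Prop :=
  ∀ a b : ℕ, 0 < a → 0 < b → Nat.Coprime a b → 2 ≤ a → a < b →
    ∀ F G : Poly,
      BracketConst F G →
      {((0 : ℝ), (0 : ℝ)), (0, 1), (1, 0)} ⊆ newton F →
      newton G = ((b : ℝ) / (a : ℝ)) • newton F →
      b * F.totalDegree = a * G.totalDegree →
      bracket F G = 0

/-- Conjecture B. The natural-number quotients `b * m / a` and `b * n / a` are exact, since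
`a` divides `m` and `n`. -/
def ConjectureB : Prop :=
  ∀ a b m n : ℕ, IsQuadruple a b m n →
    ∀ F G : Poly,
      (newton0 F = trapezoid m n ∧
        newton0 (F - X 0 ^ m * X 1 ^ n) ⊂ newton0 F) →
      (∀ i : ℕ, i ≤ m → (X 0 + 1) ^ (m - i) ∣ homComp 0 1 (n - i) F) →
      (∀ i : ℕ, i ≤ n → (X 0 + X 1) ^ (n - i) ∣ homComp 1 1 (m + n - i) F) →
      (newton0 G = trapezoid ((b * m / a : ℕ) : ℝ) ((b * n / a : ℕ) : ℝ) ∧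
        newton0 (G - X 0 ^ (b * m / a) * X 1 ^ (b * n / a)) ⊂ newton0 G) →
      BracketConst F G →
      bracket F G = 0

end JacobianTrapezoid

end

noncomputable section

namespace JacobianTrapezoid

section

/-! ### The Jacobian bracket as a derivation -/

section Bracket

/-! If Conjecture A fails, there is a pair with `[F, G]` a nonzero constant and deg F : deg G = a :
b. Polynomial automorphisms turn it into a counterexample to Conjecture B.

The local input is `exists_leading_root`. Take weights (ρ, σ) with ρ + σ > 0 for which F and G have
degrees aδ and bδ, with (a + b)δ > ρ + σ. The leading parts then commute, so up to a constant they
are R^a and R^b for one homogeneous R. Moreover some homogeneous H of the weight of xy satisfies [R,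
H] = cR with c ≠ 0, and R divides a power of H. The support of H lies on a line through (1, 1),
which often leaves only a monomial; then R is a monomial too, and the Newton polygons have no edge
in that direction (`strictlyDominates_of_monomial`).

Globally, the weight is rotated: a common corner a(p, q), b(p, q) remains extreme until an edge is
met (`dominates_of_no_edge`). Where an edge can occur, H has a simple shape and a homogeneous
automorphism makes H, hence R, a monomial (`EdgeData.exists_shear`). Among all pairs and weights (k,
1) with k ≥ 1, a choice with δ least and then k greatest forces k = 1 and, up to swapping x and y, 0
< p < q (`RatioAt.exists_corner_one_one`). Further rotations and a translation in x confine the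
exponents (i, j) of F to i ≤ ap and j - i ≤ a(q - p), and those of G likewise with b
(`RatioAt.exists_dominates`).

The substitution x ↦ x + 1, y ↦ x + y finishes. The corner monomial becomes (x + 1)^m (x + y)^n,
which carries the vertices of the trapezoid; the two inequalities become the two divisibility
conditions of Conjecture B. -/

theorem bracket_mul_right (f g h : Poly) :
    bracket f (g * h) = bracket f g * h + g * bracket f h := by
  simp only [bracket, pderiv_mul]; ring

theorem bracket_sub_right (f g h : Poly) : bracket f (g - h) = bracket f g - bracket f h := by
  simp only [bracket, map_sub]; ring

theorem bracket_C_mul_right (f g : Poly) (c : ℂ) : bracket f (C c * g) = C c * bracket f g := by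
  simp only [bracket, pderiv_C_mul]; ring

theorem bracket_C_mul_left (f g : Poly) (c : ℂ) : bracket (C c * f) g = C c * bracket f g := by
  simp only [bracket, pderiv_C_mul]; ring

theorem bracket_self (f : Poly) : bracket f f = 0 := by
  simp only [bracket]; ring

theorem bracket_zero_right (f : Poly) : bracket f 0 = 0 := by
  simp [bracket]

theorem bracket_pow_right (f g : Poly) (n : ℕ) :
    bracket f (g ^ n) = n * g ^ (n - 1) * bracket f g := by
  simp only [bracket, pderiv_pow]; ring

theorem bracket_pow_left (f g : Poly) (n : ℕ) :
    bracket (f ^ n) g = n * f ^ (n - 1) * bracket f g := by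
  simp only [bracket, pderiv_pow]; ring

end Bracket

/-! ### Integer weights, leading parts and Euler's identity -/

/-- The weight of an exponent vector. -/
def wdeg (ρ σ : ℤ) (d : Fin 2 →₀ ℕ) : ℤ := ρ * d 0 + σ * d 1

theorem wdeg_add (ρ σ : ℤ) (d e : Fin 2 →₀ ℕ) : wdeg ρ σ (d + e) = wdeg ρ σ d + wdeg ρ σ e := by
  simp only [wdeg, Finsupp.add_apply, Nat.cast_add]; ring

theorem wdeg_zero (ρ σ : ℤ) : wdeg ρ σ 0 = 0 := by simp [wdeg]

theorem weight_eq_wdeg (ρ σ : ℤ) (d : Fin 2 →₀ ℕ) : Finsupp.weight ![ρ, σ] d = wdeg ρ σ d := by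
  rw [Finsupp.weight_apply, Finsupp.sum_fintype _ _ (by simp)]
  simp [wdeg]; ring

/-- All monomials of `f` have weight at most `D`. -/
def DegLE (ρ σ D : ℤ) (f : Poly) : Prop := ∀ d ∈ f.support, wdeg ρ σ d ≤ D

/-- All monomials of `f` have weight exactly `D`. -/
def IsHom (ρ σ D : ℤ) (f : Poly) : Prop := ∀ d ∈ f.support, wdeg ρ σ d = D

/-- The part of `f` of weight `D`. -/
def part (ρ σ D : ℤ) : Poly →ₗ[ℂ] Poly := weightedHomogeneousComponent ![ρ, σ] D

variable {ρ σ D E : ℤ} {f g : Poly}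

theorem coeff_part (ρ σ D : ℤ) (f : Poly) (d : Fin 2 →₀ ℕ) :
    coeff d (part ρ σ D f) = if wdeg ρ σ d = D then coeff d f else 0 := by
  classical
  rw [part, coeff_weightedHomogeneousComponent, weight_eq_wdeg]

theorem IsHom.degLE (h : IsHom ρ σ D f) : DegLE ρ σ D f := fun d hd => (h d hd).le

theorem DegLE.mono (h : DegLE ρ σ D f) (hD : D ≤ E) : DegLE ρ σ E f :=
  fun d hd => (h d hd).trans hD

theorem isHom_part (ρ σ D : ℤ) (f : Poly) : IsHom ρ σ D (part ρ σ D f) := by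
  intro d hd
  by_contra h
  rw [mem_support_iff, coeff_part, if_neg h] at hd
  exact hd rfl

theorem IsHom.part_eq (h : IsHom ρ σ D f) : part ρ σ D f = f := by
  ext d
  rw [coeff_part]
  split_ifs with hd
  · rfl
  · by_contra hc
    exact hd (h d (mem_support_iff.2 (Ne.symm hc)))

theorem DegLE.part_eq_zero (h : DegLE ρ σ D f) (hD : D < E) : part ρ σ E f = 0 := by
  ext d
  rw [coeff_part, coeff_zero]
  split_ifs with hd
  · by_contra hc
    have := h d (mem_support_iff.2 hc)
    omega
  · rfl

theorem DegLE.zero : DegLE ρ σ D 0 := by intro d hd; simp at hd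

theorem IsHom.zero : IsHom ρ σ D 0 := by intro d hd; simp at hd

theorem DegLE.add (hf : DegLE ρ σ D f) (hg : DegLE ρ σ D g) : DegLE ρ σ D (f + g) := by
  classical
  intro d hd
  rcases Finset.mem_union.1 (support_add hd) with h | h
  exacts [hf d h, hg d h]

theorem DegLE.sub (hf : DegLE ρ σ D f) (hg : DegLE ρ σ D g) : DegLE ρ σ D (f - g) := by
  classical
  intro d hd
  rcases Finset.mem_union.1 (support_sub _ _ _ hd) with h | h
  exacts [hf d h, hg d h]

theorem IsHom.add (hf : IsHom ρ σ D f) (hg : IsHom ρ σ D g) : IsHom ρ σ D (f + g) := by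
  classical
  intro d hd
  rcases Finset.mem_union.1 (support_add hd) with h | h
  exacts [hf d h, hg d h]

theorem IsHom.sub (hf : IsHom ρ σ D f) (hg : IsHom ρ σ D g) : IsHom ρ σ D (f - g) := by
  classical
  intro d hd
  rcases Finset.mem_union.1 (support_sub _ _ _ hd) with h | h
  exacts [hf d h, hg d h]

theorem DegLE.mul (hf : DegLE ρ σ D f) (hg : DegLE ρ σ E g) : DegLE ρ σ (D + E) (f * g) := by
  classical
  intro d hd
  obtain ⟨a, ha, b, hb, rfl⟩ := Finset.mem_add.1 (support_mul f g hd)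
  rw [wdeg_add]
  exact add_le_add (hf a ha) (hg b hb)

theorem IsHom.mul (hf : IsHom ρ σ D f) (hg : IsHom ρ σ E g) : IsHom ρ σ (D + E) (f * g) := by
  classical
  intro d hd
  obtain ⟨a, ha, b, hb, rfl⟩ := Finset.mem_add.1 (support_mul f g hd)
  rw [wdeg_add, hf a ha, hg b hb]

theorem isHom_monomial (ρ σ : ℤ) (d : Fin 2 →₀ ℕ) (c : ℂ) :
    IsHom ρ σ (wdeg ρ σ d) (monomial d c) := by
  classical
  intro e he
  rw [Finset.mem_singleton.1 (support_monomial_subset he)]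

theorem isHom_C (ρ σ : ℤ) (c : ℂ) : IsHom ρ σ 0 (C c) := by
  simpa [wdeg_zero] using isHom_monomial ρ σ 0 c

theorem isHom_X0 (ρ σ : ℤ) : IsHom ρ σ ρ (X 0) := by
  simpa [wdeg] using! isHom_monomial ρ σ (Finsupp.single 0 1) 1

theorem isHom_X1 (ρ σ : ℤ) : IsHom ρ σ σ (X 1) := by
  simpa [wdeg] using! isHom_monomial ρ σ (Finsupp.single 1 1) 1

theorem DegLE.C_mul (hf : DegLE ρ σ D f) (c : ℂ) : DegLE ρ σ D (C c * f) := by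
  simpa using (isHom_C ρ σ c).degLE.mul hf

theorem IsHom.C_mul (hf : IsHom ρ σ D f) (c : ℂ) : IsHom ρ σ D (C c * f) := by
  simpa using (isHom_C ρ σ c).mul hf

theorem DegLE.pow (hf : DegLE ρ σ D f) (n : ℕ) : DegLE ρ σ (n * D) (f ^ n) := by
  induction n with
  | zero => simpa using (isHom_C ρ σ 1).degLE
  | succ n ih =>
    rw [pow_succ]
    have := ih.mul hf
    convert this using 1
    push_cast; ring

theorem IsHom.pow (hf : IsHom ρ σ D f) (n : ℕ) : IsHom ρ σ (n * D) (f ^ n) := by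
  induction n with
  | zero => simpa using isHom_C ρ σ 1
  | succ n ih =>
    rw [pow_succ]
    have := ih.mul hf
    convert this using 1
    push_cast; ring

theorem mem_support_of_pderiv {i : Fin 2} {d : Fin 2 →₀ ℕ} (hd : d ∈ (pderiv i f).support) :
    d + Finsupp.single i 1 ∈ f.support := by
  rw [mem_support_iff, coeff_pderiv] at hd
  exact mem_support_iff.2 (left_ne_zero_of_mul hd)

theorem wdeg_single_zero (ρ σ : ℤ) (n : ℕ) : wdeg ρ σ (Finsupp.single 0 n) = ρ * n := by
  simp [wdeg]

theorem wdeg_single_one (ρ σ : ℤ) (n : ℕ) : wdeg ρ σ (Finsupp.single 1 n) = σ * n := by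
  simp [wdeg]

theorem DegLE.pderiv_zero (hf : DegLE ρ σ D f) : DegLE ρ σ (D - ρ) (pderiv 0 f) := by
  intro d hd
  have := hf _ (mem_support_of_pderiv hd)
  rw [wdeg_add, wdeg_single_zero] at this
  push_cast at this
  linarith

theorem DegLE.pderiv_one (hf : DegLE ρ σ D f) : DegLE ρ σ (D - σ) (pderiv 1 f) := by
  intro d hd
  have := hf _ (mem_support_of_pderiv hd)
  rw [wdeg_add, wdeg_single_one] at this
  push_cast at this
  linarith

theorem IsHom.pderiv_zero (hf : IsHom ρ σ D f) : IsHom ρ σ (D - ρ) (pderiv 0 f) := by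
  intro d hd
  have := hf _ (mem_support_of_pderiv hd)
  rw [wdeg_add, wdeg_single_zero] at this
  push_cast at this
  linarith

theorem IsHom.pderiv_one (hf : IsHom ρ σ D f) : IsHom ρ σ (D - σ) (pderiv 1 f) := by
  intro d hd
  have := hf _ (mem_support_of_pderiv hd)
  rw [wdeg_add, wdeg_single_one] at this
  push_cast at this
  linarith

theorem DegLE.degLE_bracket (hf : DegLE ρ σ D f) (hg : DegLE ρ σ E g) :
    DegLE ρ σ (D + E - (ρ + σ)) (bracket f g) := by
  have h1 := hf.pderiv_zero.mul hg.pderiv_one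
  have h2 := hg.pderiv_zero.mul hf.pderiv_one
  refine DegLE.sub ?_ ?_
  · convert h1 using 1; ring
  · convert h2 using 1; ring

theorem IsHom.isHom_bracket (hf : IsHom ρ σ D f) (hg : IsHom ρ σ E g) :
    IsHom ρ σ (D + E - (ρ + σ)) (bracket f g) := by
  have h1 := hf.pderiv_zero.mul hg.pderiv_one
  have h2 := hg.pderiv_zero.mul hf.pderiv_one
  refine IsHom.sub ?_ ?_
  · convert h1 using 1; ring
  · convert h2 using 1; ring

theorem DegLE.of_part_eq_zero (hf : DegLE ρ σ D f) (h : part ρ σ D f = 0) :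
    DegLE ρ σ (D - 1) f := by
  intro d hd
  have h1 := hf d hd
  have h2 : coeff d (part ρ σ D f) = 0 := by rw [h, coeff_zero]
  rw [coeff_part] at h2
  split_ifs at h2 with h3
  · exact absurd h2 (mem_support_iff.1 hd)
  · omega

theorem DegLE.sub_part (hf : DegLE ρ σ D f) : DegLE ρ σ (D - 1) (f - part ρ σ D f) := by
  refine (hf.sub (isHom_part ρ σ D f).degLE).of_part_eq_zero ?_
  rw [map_sub, (isHom_part ρ σ D f).part_eq, sub_self]

theorem part_mul (hf : DegLE ρ σ D f) (hg : DegLE ρ σ E g) :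
    part ρ σ (D + E) (f * g) = part ρ σ D f * part ρ σ E g := by
  have e : f * g = part ρ σ D f * part ρ σ E g +
      (part ρ σ D f * (g - part ρ σ E g) + (f - part ρ σ D f) * g) := by ring
  have h1 := (isHom_part ρ σ D f).degLE.mul hg.sub_part
  have h2 := hf.sub_part.mul hg
  have h3 : DegLE ρ σ (D + E - 1) (part ρ σ D f * (g - part ρ σ E g) + (f - part ρ σ D f) * g) :=
    DegLE.add (h1.mono (by omega)) (h2.mono (by omega))
  conv_lhs => rw [e]
  rw [map_add, h3.part_eq_zero (by omega), add_zero,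
    ((isHom_part ρ σ D f).mul (isHom_part ρ σ E g)).part_eq]

theorem part_pow (hf : DegLE ρ σ D f) (n : ℕ) :
    part ρ σ (n * D) (f ^ n) = part ρ σ D f ^ n := by
  induction n with
  | zero => simpa using (isHom_C ρ σ 1).part_eq
  | succ n ih =>
    have := part_mul (hf.pow n) hf
    rw [pow_succ, pow_succ, ← ih, ← this]
    congr 2
    push_cast; ring

/-- The bracket lowers weight by ρ + σ, so replacing f or g by its remainder below the top weight
only affects lower weights. -/
theorem part_bracket (hf : DegLE ρ σ D f) (hg : DegLE ρ σ E g) :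
    part ρ σ (D + E - (ρ + σ)) (bracket f g) = bracket (part ρ σ D f) (part ρ σ E g) := by
  have e : bracket f g = bracket (part ρ σ D f) (part ρ σ E g) +
      (bracket (part ρ σ D f) (g - part ρ σ E g) + bracket (f - part ρ σ D f) g) := by
    simp only [bracket, map_sub]; ring
  have h1 := (isHom_part ρ σ D f).degLE.degLE_bracket hg.sub_part
  have h2 := hf.sub_part.degLE_bracket hg
  have h3 := DegLE.add (h1.mono (E := D + E - (ρ + σ) - 1) (by omega)) (h2.mono (by omega))
  conv_lhs => rw [e]
  rw [map_add, h3.part_eq_zero (by omega), add_zero,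
    ((isHom_part ρ σ D f).isHom_bracket (isHom_part ρ σ E g)).part_eq]

theorem part_C_mul (c : ℂ) (f : Poly) : part ρ σ D (C c * f) = C c * part ρ σ D f := by
  rw [C_mul', C_mul', map_smul]

theorem part_mul_of_isHom_left (hf : IsHom ρ σ D f) (g : Poly) (E : ℤ) :
    part ρ σ E (f * g) = f * part ρ σ (E - D) g := by
  classical
  induction g using MvPolynomial.induction_on' with
  | monomial d c =>
    have h := isHom_monomial ρ σ d c
    by_cases hd : wdeg ρ σ d = E - D
    · have h2 := hf.mul h
      rw [hd] at h h2
      rw [h.part_eq]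
      convert h2.part_eq
      ring
    · have h1 : part ρ σ (E - D) (monomial d c) = 0 := by
        ext e
        rw [coeff_part, coeff_zero]
        split_ifs with he
        · by_contra hc
          have := h e (mem_support_iff.2 hc)
          omega
        · rfl
      rw [h1, mul_zero]
      have h2 := hf.mul h
      ext e
      rw [coeff_part, coeff_zero]
      split_ifs with he
      · by_contra hc
        have := h2 e (mem_support_iff.2 hc)
        omega
      · rfl
  | add p q hp hq => rw [mul_add, map_add, map_add, hp, hq, mul_add]

/-- Euler's identity. -/
theorem IsHom.euler (hf : IsHom ρ σ D f) :
    C (ρ : ℂ) * (X 0 * pderiv 0 f) + C (σ : ℂ) * (X 1 * pderiv 1 f) = C (D : ℂ) * f := by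
  classical
  rw [f.as_sum]
  simp only [map_sum, Finset.mul_sum, ← Finset.sum_add_distrib]
  refine Finset.sum_congr rfl fun d hd => ?_
  rw [X_mul_pderiv_monomial, X_mul_pderiv_monomial, ← hf d hd]
  simp only [wdeg, nsmul_eq_mul, Int.cast_add, Int.cast_mul, Int.cast_natCast, map_add, map_mul,
    map_natCast]
  ring

theorem coeff_X_mul_pderiv (i : Fin 2) (f : Poly) (d : Fin 2 →₀ ℕ) :
    coeff d (X i * pderiv i f) = d i * coeff d f := by
  classical
  induction f using MvPolynomial.induction_on' with
  | monomial e c =>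
    rw [X_mul_pderiv_monomial, coeff_smul, coeff_monomial]
    split_ifs with h
    · rw [h, nsmul_eq_mul]
    · simp
  | add p q hp hq => rw [map_add, mul_add, coeff_add, coeff_add, hp, hq, mul_add]

/-- Converse of Euler's identity, by comparing coefficients. It lets homogeneity pass from a power
to its root in `IsHom.of_pow`. -/
theorem isHom_of_euler
    (h : C (ρ : ℂ) * (X 0 * pderiv 0 f) + C (σ : ℂ) * (X 1 * pderiv 1 f) = C (D : ℂ) * f) :
    IsHom ρ σ D f := by
  classical
  intro d hd
  have h2 := congrArg (coeff d) h
  rw [coeff_add, coeff_C_mul, coeff_C_mul, coeff_C_mul, coeff_X_mul_pderiv,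
    coeff_X_mul_pderiv] at h2
  have h3 : ((ρ * d 0 + σ * d 1 : ℤ) : ℂ) = (D : ℂ) := by
    apply mul_right_cancel₀ (mem_support_iff.1 hd)
    push_cast
    linear_combination h2
  exact_mod_cast h3

theorem eq_C_of_pderiv_eq_zero (h0 : pderiv 0 f = 0) (h1 : pderiv 1 f = 0) :
    ∃ c, f = C c := by
  refine ⟨coeff 0 f, ?_⟩
  ext d
  rw [coeff_C]
  split_ifs with hd
  · rw [← hd]
  · by_contra hc
    have h : ∀ i : Fin 2, pderiv i f = 0 → d i = 0 := by
      intro i hi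
      by_contra hdi
      have h2 := congrArg (coeff (d - Finsupp.single i 1)) hi
      rw [coeff_pderiv, coeff_zero, tsub_add_cancel_of_le] at h2
      · rcases mul_eq_zero.1 h2 with h3 | h3
        · exact hc h3
        · exact Nat.cast_add_one_ne_zero _ h3
      · rw [Finsupp.single_le_iff]; omega
    exact hd (by ext i; fin_cases i; exacts [(h 0 h0).symm, (h 1 h1).symm])

end

/-! ### Commuting homogeneous polynomials and common roots -/

section

variable {ρ σ D E p q : ℤ} {f g P Q R H U V : Poly}

theorem IsHom.unique (h1 : IsHom ρ σ D f) (h2 : IsHom ρ σ E f) (hf : f ≠ 0) : D = E := by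
  obtain ⟨d, hd⟩ := support_nonempty.2 hf
  rw [← h1 d hd, h2 d hd]

theorem IsHom.of_mul_left (hf : IsHom ρ σ D f) (hf0 : f ≠ 0) (h : IsHom ρ σ E (f * g)) :
    IsHom ρ σ (E - D) g := by
  have h1 := h.part_eq
  rw [part_mul_of_isHom_left hf] at h1
  rw [← mul_left_cancel₀ hf0 h1]
  exact isHom_part _ _ _ _

theorem IsHom.euler_bracket_one (hP : IsHom ρ σ p P) (hQ : IsHom ρ σ q Q) :
    C (p : ℂ) * P * pderiv 1 Q - C (q : ℂ) * Q * pderiv 1 P = C (ρ : ℂ) * X 0 * bracket P Q := by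
  have h1 := hP.euler
  have h2 := hQ.euler
  simp only [bracket]
  linear_combination (-pderiv 1 Q) * h1 + pderiv 1 P * h2

theorem IsHom.euler_bracket_zero (hP : IsHom ρ σ p P) (hQ : IsHom ρ σ q Q) :
    C (p : ℂ) * P * pderiv 0 Q - C (q : ℂ) * Q * pderiv 0 P =
      -C (σ : ℂ) * X 1 * bracket P Q := by
  have h1 := hP.euler
  have h2 := hQ.euler
  simp only [bracket]
  linear_combination (-pderiv 0 Q) * h1 + pderiv 0 P * h2

/-- Each Euler relation holds up to a multiple of the bracket. -/
theorem IsHom.exists_euler_bracket (hP : IsHom ρ σ p P) (hQ : IsHom ρ σ q Q) (i : Fin 2) :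
    ∃ T, C (p : ℂ) * P * pderiv i Q - C (q : ℂ) * Q * pderiv i P = T * bracket P Q := by
  fin_cases i
  exacts [⟨_, hP.euler_bracket_zero hQ⟩, ⟨_, hP.euler_bracket_one hQ⟩]

/-- The quotient U / V has zero gradient. To stay within polynomials, c is chosen to cancel in U the
lexicographic leading monomial of V. The difference W = U - cV satisfies the same relations; if
nonzero, comparing leading coefficients gives it the leading exponent of V, where its coefficient
vanishes. -/
theorem eq_C_mul_of_mul_pderiv_eq (hV : V ≠ 0)
    (h : ∀ i : Fin 2, U * pderiv i V = V * pderiv i U) : ∃ c, U = C c * V := by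
  classical
  let m : MonomialOrder (Fin 2) := MonomialOrder.lex
  set d := m.degree V with hd
  have hVd : coeff d V ≠ 0 := m.leadingCoeff_ne_zero_iff.2 hV
  set c := coeff d U / coeff d V with hc
  refine ⟨c, sub_eq_zero.1 ?_⟩
  by_contra hW
  set W := U - C c * V with hWdef
  set e := m.degree W with he
  have hWe : coeff e W ≠ 0 := m.leadingCoeff_ne_zero_iff.2 hW
  have hWd : coeff d W = 0 := by
    rw [hWdef, coeff_sub, coeff_C_mul, hc, div_mul_cancel₀ _ hVd, sub_self]
  have hle : ∀ (i : Fin 2) (f : Poly), m.toSyn (m.degree (X i * pderiv i f)) ≤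
      m.toSyn (m.degree f) := by
    intro i f
    rw [m.degree_le_iff]
    intro b hb
    apply m.le_degree
    rw [mem_support_iff, coeff_X_mul_pderiv] at hb
    exact mem_support_iff.2 (right_ne_zero_of_mul hb)
  have hi : ∀ i : Fin 2, d i = e i := by
    intro i
    have h1 : W * (X i * pderiv i V) = V * (X i * pderiv i W) := by
      rw [hWdef, map_sub, pderiv_C_mul]
      linear_combination X i * h i
    have h2 := m.coeff_mul_of_add_of_degree_le (f := W) (g := X i * pderiv i V) (a := e) (b := d)
      le_rfl (hle i V)
    have h3 := m.coeff_mul_of_add_of_degree_le (f := V) (g := X i * pderiv i W) (a := d) (b := e)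
      le_rfl (hle i W)
    rw [h1, add_comm, h3, coeff_X_mul_pderiv, coeff_X_mul_pderiv] at h2
    have h4 : coeff d V * coeff e W * (e i : ℂ) = coeff d V * coeff e W * (d i : ℂ) := by
      linear_combination h2
    exact_mod_cast (mul_left_cancel₀ (mul_ne_zero hVd hWe) h4).symm
  have hde : d = e := Finsupp.ext hi
  rw [← hde] at hWe
  exact hWe hWd

/-- Commuting homogeneous polynomials are algebraically dependent. -/
theorem IsHom.exists_pow_eq (hP : IsHom ρ σ p P) (hQ : IsHom ρ σ q Q) (hp : p ≠ 0)
    (hP0 : P ≠ 0) (hQ0 : Q ≠ 0) (hb : bracket P Q = 0) (m n : ℕ) (hmn : m * q = n * p) :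
    ∃ c, c ≠ 0 ∧ Q ^ m = C c * P ^ n := by
  have hpC : (C (p : ℂ) : Poly) ≠ 0 := by simpa using hp
  have h1 : ∀ i : Fin 2, (m : Poly) * (P * pderiv i Q) = n * (Q * pderiv i P) := by
    intro i
    obtain ⟨T, hT⟩ := hP.exists_euler_bracket hQ i
    rw [hb, mul_zero, sub_eq_zero] at hT
    apply mul_left_cancel₀ hpC
    have h2 : (m : Poly) * (C (q : ℂ) : Poly) = (n : Poly) * (C (p : ℂ) : Poly) := by
      have : ((m * q : ℤ) : ℂ) = ((n * p : ℤ) : ℂ) := by rw [hmn]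
      push_cast at this
      rw [← C_eq_coe_nat, ← C_eq_coe_nat, ← map_mul, ← map_mul, this]
    linear_combination m * hT + Q * pderiv i P * h2
  have hpow : ∀ (i : Fin 2) (A : Poly) (k : ℕ), A * pderiv i (A ^ k) = k * A ^ k * pderiv i A := by
    intro i A k
    rw [pderiv_pow]
    rcases k with _ | k
    · simp
    · rw [Nat.add_sub_cancel, pow_succ]; ring
  obtain ⟨c, hc⟩ := eq_C_mul_of_mul_pderiv_eq (U := Q ^ m) (V := P ^ n) (pow_ne_zero n hP0) (by
    intro i
    apply mul_left_cancel₀ (mul_ne_zero hP0 hQ0)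
    linear_combination Q * Q ^ m * hpow i P n - P * P ^ n * hpow i Q m - Q ^ m * P ^ n * h1 i)
  refine ⟨c, ?_, hc⟩
  rintro rfl
  rw [map_zero, zero_mul] at hc
  exact pow_ne_zero m hQ0 hc

theorem IsHom.not_isUnit (hR : IsHom ρ σ D R) (hD : D ≠ 0) : ¬ IsUnit R := by
  intro hu
  obtain ⟨c, -, rfl⟩ := MvPolynomial.isUnit_iff_eq_C_of_isReduced.1 hu
  by_cases hc : c = 0
  · subst hc; simp at hu
  · exact hD (hR.unique (isHom_C ρ σ c) (by simpa using hc))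

/-- If q = -r < 0, then P^r Q^p has weight zero and commutes with P, so it is a constant and P is a
unit, contrary to p > 0. -/
theorem IsHom.nonneg_of_bracket_eq_zero (hP : IsHom ρ σ p P) (hQ : IsHom ρ σ q Q) (hp : 0 < p)
    (hP0 : P ≠ 0) (hQ0 : Q ≠ 0) (hb : bracket P Q = 0) : 0 ≤ q := by
  by_contra hq
  push Not at hq
  lift p to ℕ using hp.le
  obtain ⟨r, rfl⟩ : ∃ r : ℕ, q = -r := ⟨(-q).toNat, by omega⟩
  -- `P ^ r * Q` has weight zero after raising `Q` to the power `p`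
  have hPQ : IsHom ρ σ 0 (P ^ r * Q ^ p) := by
    convert (hP.pow r).mul (hQ.pow p) using 1
    ring
  have hb2 : bracket P (P ^ r * Q ^ p) = 0 := by
    rw [bracket_mul_right, bracket_pow_right, bracket_pow_right, hb, bracket_self]; simp
  obtain ⟨c, hc0, hc⟩ := hP.exists_pow_eq hPQ (by omega) hP0
    (mul_ne_zero (pow_ne_zero _ hP0) (pow_ne_zero _ hQ0)) hb2 1 0 (by simp)
  refine hP.not_isUnit (by omega) ?_
  have hu : IsUnit (P ^ r * Q ^ p) := by
    rw [← pow_one (P ^ r * Q ^ p), hc, pow_zero, mul_one]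
    exact (isUnit_iff_ne_zero.2 hc0).map C
  exact (isUnit_pow_iff (by omega)).1 (isUnit_of_mul_isUnit_left hu)

/-- With ub - va = 1, the fraction S = G^u / F^v satisfies S^a = c^u F. It is a polynomial because
the polynomial ring is integrally closed, and a scalar multiple of it is the root R. -/
theorem exists_root_of_pow_eq {a b : ℕ} {F G : Poly} (ha : 0 < a) (hab : Nat.Coprime a b)
    (hb : 0 < b) (hF : F ≠ 0)  {c : ℂ} (hc : c ≠ 0) (h : G ^ a = C c * F ^ b) :
    ∃ R c', F = R ^ a ∧ c' ≠ 0 ∧ G = C c' * R ^ b := by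
  obtain ⟨u, v, huv⟩ : ∃ u v : ℕ, u * b = v * a + 1 := by
    rcases Nat.lt_or_ge 1 a with ha1 | ha1
    · obtain ⟨u, -, hu⟩ := Nat.exists_mul_mod_eq_one_of_coprime hab.symm ha1
      refine ⟨u, b * u / a, ?_⟩
      have := Nat.div_add_mod (b * u) a
      rw [hu] at this
      rw [mul_comm u b, mul_comm _ a, this]
    · obtain rfl : a = 1 := by omega
      refine ⟨1, b - 1, by omega⟩
  have hdvd : F ^ v ∣ G ^ u := by
    rw [← IsIntegrallyClosed.pow_dvd_pow_iff ha.ne']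
    refine ⟨C (c ^ u) * F, ?_⟩
    rw [← pow_mul, mul_comm u a, pow_mul, h, mul_pow, ← pow_mul, mul_comm b u, huv, ← pow_mul,
      C_pow, pow_succ]
    ring
  obtain ⟨S, hS⟩ := hdvd
  have hSa : S ^ a = C (c ^ u) * F := by
    apply mul_left_cancel₀ (pow_ne_zero (v * a) hF)
    rw [pow_mul, ← mul_pow, ← hS, ← pow_mul, mul_comm u a, pow_mul, h, mul_pow, ← pow_mul,
      mul_comm b u, huv, C_pow, pow_succ, pow_mul]
    ring
  obtain ⟨t, ht⟩ := IsAlgClosed.exists_pow_nat_eq (c ^ u)⁻¹ ha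
  have hR : F = (C t * S) ^ a := by
    rw [mul_pow, hSa, ← C_pow, ht, ← mul_assoc, ← C_mul, inv_mul_cancel₀ (pow_ne_zero u hc),
      C_1, one_mul]
  have hR0 : (C t * S) ≠ 0 := by
    intro h0
    rw [h0, zero_pow ha.ne'] at hR
    exact hF hR
  have hdvd2 : (C t * S) ^ b ∣ G := by
    rw [← IsIntegrallyClosed.pow_dvd_pow_iff ha.ne']
    refine ⟨C c, ?_⟩
    rw [h, hR]; ring
  obtain ⟨T, hT⟩ := hdvd2
  have hTa : T ^ a = C c := by
    apply mul_left_cancel₀ (pow_ne_zero (b * a) hR0)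
    rw [pow_mul, ← mul_pow, ← hT, h, hR]; ring
  have hTu : IsUnit T := by
    rw [← isUnit_pow_iff ha.ne', hTa]
    exact (isUnit_iff_ne_zero.2 hc).map C
  obtain ⟨c', hc', rfl⟩ := MvPolynomial.isUnit_iff_eq_C_of_isReduced.1 hTu
  exact ⟨C t * S, c', hR, hc'.ne_zero, by rw [hT, mul_comm]⟩

theorem IsHom.of_pow {n : ℕ} (hn : n ≠ 0) (hR0 : R ≠ 0) (h : IsHom ρ σ (n * D) (R ^ n)) :
    IsHom ρ σ D R := by
  apply isHom_of_euler
  have h1 := h.euler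
  rw [pderiv_pow, pderiv_pow] at h1
  obtain ⟨k, rfl⟩ := Nat.exists_eq_succ_of_ne_zero hn
  have h2 : ((k.succ : Poly) * R ^ k) ≠ 0 :=
    mul_ne_zero (Nat.cast_ne_zero.2 (Nat.succ_ne_zero k)) (pow_ne_zero _ hR0)
  apply mul_left_cancel₀ h2
  have h3 : (C (((k.succ : ℤ) * D : ℤ) : ℂ) : Poly) = (k.succ : Poly) * (C (D : ℂ) : Poly) := by
    rw [Int.cast_mul, map_mul, Int.cast_natCast, C_eq_coe_nat]
  rw [h3, Nat.succ_sub_one, pow_succ] at h1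
  linear_combination h1

theorem bracket_eq_zero_of_pow_left {a : ℕ} (ha : a ≠ 0) (hR : R ≠ 0)
    (h : bracket (R ^ a) Q = 0) : bracket R Q = 0 := by
  rw [bracket_pow_left] at h
  refine (mul_eq_zero.1 h).resolve_left (mul_ne_zero ?_ (pow_ne_zero _ hR))
  exact_mod_cast ha

/-- Replacing `Q` by polynomials in `P` and `Q` until the leading parts stop commuting. -/
theorem exists_bracket_eq_pow {a δ : ℕ} (hδ : 0 < δ) (ha : 0 < a) (hR : IsHom ρ σ δ R)
    (hR0 : R ≠ 0) (hP : DegLE ρ σ (a * δ) P) (hPR : part ρ σ (a * δ) P = R ^ a) (N : ℕ) :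
    ∀ (Q J : Poly) (v j : ℤ), DegLE ρ σ v Q → DegLE ρ σ j (bracket P Q) →
      part ρ σ j (bracket P Q) = J → J ≠ 0 → bracket R J = 0 → a * δ + v - (ρ + σ) - j ≤ N →
      ∃ (E : Poly) (e : ℤ) (k : ℕ) (c : ℂ),
        IsHom ρ σ e E ∧ c ≠ 0 ∧ bracket R E = C c * R ^ (k + 1) := by
  have haδ : (0 : ℤ) < a * δ := by positivity
  induction N with
  | zero =>
    intro Q J v j hQ hB hJ hJ0 hRJ hN
    have hjle : a * δ + v - (ρ + σ) = j := by
      by_contra hne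
      exact hJ0 (hJ ▸ (hP.degLE_bracket hQ).part_eq_zero (by push_cast at hN; omega))
    have hJh : IsHom ρ σ j J := hJ ▸ isHom_part _ _ _ _
    have hj0 : 0 ≤ j := hR.nonneg_of_bracket_eq_zero hJh (by exact_mod_cast hδ) hR0 hJ0 hRJ
    lift j to ℕ using hj0
    obtain ⟨c, hc0, hc⟩ := hR.exists_pow_eq hJh (by exact_mod_cast hδ.ne') hR0 hJ0 hRJ δ j
      (mul_comm _ _)
    have h1 := part_bracket hP hQ
    rw [hjle, hJ, hPR, bracket_pow_left] at h1
    -- Without a gap, J = a R^(a-1) [R, Q_v] for the top part Q_v of Q. Hence this witness has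
    -- bracket J^δ R with R, and J^δ = c R^j.
    refine ⟨C (a : ℂ) * (part ρ σ v Q * J ^ (δ - 1) * R ^ a), _, j, c,
      (((isHom_part _ _ _ _).mul (hJh.pow _)).mul (hR.pow _)).C_mul _, hc0, ?_⟩
    obtain ⟨d, rfl⟩ := Nat.exists_eq_succ_of_ne_zero hδ.ne'
    obtain ⟨a', rfl⟩ := Nat.exists_eq_succ_of_ne_zero ha.ne'
    rw [bracket_C_mul_right, bracket_mul_right, bracket_mul_right, bracket_pow_right R J,
      bracket_pow_right R R, hRJ, bracket_self, C_eq_coe_nat]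
    simp only [Nat.succ_sub_one, mul_zero, add_zero, Nat.succ_eq_add_one] at h1 hc ⊢
    linear_combination (-J ^ d * R) * h1 + R * hc
  | succ N ih =>
    intro Q J v j hQ hB hJ hJ0 hRJ hN
    by_cases hgap : a * δ + v - (ρ + σ) - j ≤ N
    · exact ih Q J v j hQ hB hJ hJ0 hRJ hgap
    have hlt : j < a * δ + v - (ρ + σ) := by push_cast at hN; omega
    have h1 := part_bracket hP hQ
    rw [hB.part_eq_zero hlt, hPR] at h1
    by_cases hQ0 : part ρ σ v Q = 0
    · exact ih Q J (v - 1) j (hQ.of_part_eq_zero hQ0) hB hJ hJ0 hRJ (by push_cast at hN; omega)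
    have hRQ : bracket R (part ρ σ v Q) = 0 := bracket_eq_zero_of_pow_left ha.ne' hR0 h1.symm
    have hv0 : 0 ≤ v := hR.nonneg_of_bracket_eq_zero (isHom_part _ _ _ _) (by exact_mod_cast hδ)
      hR0 hQ0 hRQ
    lift v to ℕ using hv0
    -- The top part of Q commutes with R, so its power aδ is c times the power v of the top part of
    -- P. Replacing Q by Q^(aδ) - c P^v cancels the top, while [P, Q] is only multiplied by aδ
    -- Q^(aδ-1). The gap thus drops by one.
    obtain ⟨c, hc0, hc⟩ := (hR.pow a).exists_pow_eq (isHom_part ρ σ v Q) haδ.ne'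
      (pow_ne_zero _ hR0) hQ0 h1.symm (a * δ) v (by push_cast; ring)
    obtain ⟨M, hM⟩ : ∃ M, a * δ = M + 1 :=
      Nat.exists_eq_succ_of_ne_zero (mul_pos ha hδ).ne'
    have hMz : (a * δ : ℤ) = M + 1 := by exact_mod_cast hM
    have hQ' : DegLE ρ σ ((M + 1 : ℕ) * v) (Q ^ (M + 1) - C c * P ^ v) := by
      refine (hQ.pow _).sub (DegLE.C_mul ?_ c)
      convert hP.pow v using 1
      rw [hMz]; push_cast; ring
    have hQ'' : DegLE ρ σ ((M + 1 : ℕ) * v - 1) (Q ^ (M + 1) - C c * P ^ v) := by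
      refine hQ'.of_part_eq_zero ?_
      rw [map_sub, part_C_mul, part_pow hQ, ← hM, hc]
      have h2 := part_pow hP v
      rw [hPR] at h2
      rw [← h2, sub_eq_zero]
      congr 3
      push_cast; ring
    have hb' : bracket P (Q ^ (M + 1) - C c * P ^ v) = C ((M : ℂ) + 1) * (Q ^ M * bracket P Q) := by
      rw [bracket_sub_right, bracket_C_mul_right, bracket_pow_right, bracket_pow_right,
        bracket_self]
      simp only [Nat.add_sub_cancel, map_add, map_natCast, map_one, Nat.cast_add, Nat.cast_one]
      ring
    refine ih (Q ^ (M + 1) - C c * P ^ v) (C ((M : ℂ) + 1) * (part ρ σ v Q ^ M * J))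
      ((M + 1 : ℕ) * v - 1) (M * v + j) hQ'' ?_ ?_ ?_ ?_ ?_
    · rw [hb']
      exact ((hQ.pow M).mul hB).C_mul _
    · rw [hb', part_C_mul, part_mul (hQ.pow M) hB, part_pow hQ, hJ]
    · refine mul_ne_zero ?_ (mul_ne_zero (pow_ne_zero _ hQ0) hJ0)
      simpa using Nat.cast_add_one_ne_zero (R := Poly) M
    · rw [bracket_C_mul_right, bracket_mul_right, bracket_pow_right, hRQ, hRJ]; simp
    · push_cast at hN ⊢
      linarith

end

/-! ### The homogeneous solution of [R, H] = cR -/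

section

variable {ρ σ D E p q : ℤ} {f g P Q R H U V : Poly}

theorem totalDegree_pderiv_lt {i : Fin 2} (h : pderiv i f ≠ 0) :
    (pderiv i f).totalDegree < f.totalDegree := by
  have key : ∀ d ∈ (pderiv i f).support, (d.sum fun _ e => e) < f.totalDegree := by
    intro d hd
    have h1 := le_totalDegree (mem_support_of_pderiv hd)
    rw [Finsupp.sum_add_index' (by simp) (by simp), Finsupp.sum_single_index rfl] at h1
    omega
  obtain ⟨d, hd⟩ := support_nonempty.2 h
  exact (Finset.sup_lt_iff (lt_of_le_of_lt (Nat.zero_le _) (key d hd))).2 key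

/-- A nonzero derivative has smaller degree than π, so divisibility would make both derivatives zero
and π constant. -/
theorem exists_not_dvd_pderiv {π : Poly} (h : Prime π) : ∃ i : Fin 2, ¬ π ∣ pderiv i π := by
  by_contra hall
  push Not at hall
  have h0 : ∀ i : Fin 2, pderiv i π = 0 := by
    intro i
    by_contra hne
    obtain ⟨g, hg⟩ := hall i
    have h1 := totalDegree_pderiv_lt hne
    have hg0 : g ≠ 0 := by rintro rfl; simp [hg] at hne
    rw [hg, totalDegree_mul_of_isDomain h.ne_zero hg0] at h1
    omega
  obtain ⟨c, hc⟩ := eq_C_of_pderiv_eq_zero (h0 0) (h0 1)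
  have hc0 : c ≠ 0 := by rintro rfl; exact h.ne_zero (by rw [hc, C_0])
  exact h.not_isUnit (hc ▸ (isUnit_iff_ne_zero.2 hc0).map C)

theorem mul_pderiv_pow_mul (i : Fin 2) (π A : Poly) (n : ℕ) :
    π * pderiv i (π ^ n * A) = π ^ n * (n * pderiv i π * A + π * pderiv i A) := by
  rw [pderiv_mul, pderiv_pow]
  rcases n with _ | n
  · simp
  · rw [Nat.add_sub_cancel, pow_succ]; ring

theorem exists_eq_pow_mul {π f : Poly} (hπ : Prime π) (hf : f ≠ 0) :
    ∃ (n : ℕ) (g : Poly), ¬ π ∣ g ∧ f = π ^ n * g :=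
  let ⟨g, h1, h2⟩ := (FiniteMultiplicity.of_prime_left hπ hf).exists_eq_pow_mul_and_not_dvd
  ⟨_, g, h2, h1⟩

/-- Suppose a prime π has order γ + α in R but only γ in G, with α > 0. In the relation δ R ∂G - e G
∂R = T c R^(k+2) the left side has order 2γ + α - 1 for a suitable partial derivative, provided δγ ≠
e(γ + α). The right side has order at least 2(γ + α). -/
theorem dvd_of_bracket_eq_pow {δ : ℕ} {e : ℤ} {G : Poly} {c : ℂ} {k : ℕ} (hδ : 0 < δ)
    (hρσ : 0 < ρ + σ) (hR : IsHom ρ σ δ R) (hR0 : R ≠ 0) (hG : IsHom ρ σ e G) (hc : c ≠ 0)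
    (h : bracket R G = C c * R ^ (k + 2)) : R ∣ G := by
  have he : e = (k + 1) * δ + (ρ + σ) := by
    have h1 := hR.isHom_bracket hG
    rw [h] at h1
    have h2 := ((hR.pow (k + 2)).C_mul c).unique h1
      (mul_ne_zero (by simpa using hc) (pow_ne_zero _ hR0))
    push_cast at h2
    linarith
  obtain ⟨A, B, g, hAB, rfl, rfl⟩ := UniqueFactorizationMonoid.exists_reduced_factors R hR0 G
  by_cases hA : IsUnit A
  · exact mul_dvd_mul_left g hA.dvd
  exfalso
  have hA0 : A ≠ 0 := right_ne_zero_of_mul hR0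
  have hg0 : g ≠ 0 := left_ne_zero_of_mul hR0
  obtain ⟨π, hπi, hπA⟩ := WfDvdMonoid.exists_irreducible_factor hA hA0
  have hπ : Prime π := hπi.prime
  have hπB : ¬ π ∣ B := fun hB => hπ.not_isUnit (hAB hπA hB)
  obtain ⟨α, A', hA', hAe⟩ := exists_eq_pow_mul hπ hA0
  obtain ⟨γ, g', hg', hge⟩ := exists_eq_pow_mul hπ hg0
  have hα : α ≠ 0 := by
    rintro rfl
    rw [pow_zero, one_mul] at hAe
    exact hA' (hAe ▸ hπA)
  obtain ⟨i, hi⟩ := exists_not_dvd_pderiv hπ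
  have hRe : g * A = π ^ (γ + α) * (g' * A') := by rw [hge, hAe]; ring
  have hGe : g * B = π ^ γ * (g' * B) := by rw [hge]; ring
  obtain ⟨T, hT⟩ := hR.exists_euler_bracket hG i
  rw [h, hRe, hGe] at hT
  have h1 := mul_pderiv_pow_mul i π (g' * A') (γ + α)
  have h2 := mul_pderiv_pow_mul i π (g' * B) γ
  have hdvd : π ∣ ((C ((δ : ℤ) : ℂ) : Poly) * (γ : Poly) -
      (C (e : ℂ) : Poly) * ((γ + α : ℕ) : Poly)) *
      (pderiv i π * (g' * A') * (g' * B)) := by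
    refine ⟨T * C c * π ^ (α + (γ + α) * k) * (g' * A') ^ (k + 2) -
      C ((δ : ℤ) : ℂ) * (g' * A') * pderiv i (g' * B) +
      C (e : ℂ) * (g' * B) * pderiv i (g' * A'), ?_⟩
    apply mul_left_cancel₀ (pow_ne_zero (γ + (γ + α)) hπ.ne_zero)
    have h3 : (π ^ (γ + α) * (g' * A')) ^ (k + 2) =
        π ^ (γ + (γ + α)) * π ^ (α + (γ + α) * k) * (g' * A') ^ (k + 2) := by
      rw [mul_pow, ← pow_mul, ← pow_add]
      congr 2
      ring
    rw [h3] at hT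
    rw [pow_add π γ (γ + α)] at hT ⊢
    linear_combination π * hT - C ((δ : ℤ) : ℂ) * π ^ (γ + α) * (g' * A') * h2 +
      C (e : ℂ) * π ^ γ * (g' * B) * h1
  have hC : (C ((δ : ℤ) : ℂ) : Poly) * (γ : Poly) - (C (e : ℂ) : Poly) * ((γ + α : ℕ) : Poly) =
      C ((δ * γ - e * (γ + α : ℕ) : ℤ) : ℂ) := by
    push_cast
    simp only [map_sub, map_mul, map_add, map_natCast]
  rw [hC] at hdvd
  -- Comparing weights gave e = (k + 1)δ + ρ + σ > δ, so the difference is negative.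
  have hne : (δ * γ - e * (γ + α : ℕ) : ℤ) ≠ 0 := by
    have hα' : (1 : ℤ) ≤ α := by omega
    have hδ' : (1 : ℤ) ≤ δ := by omega
    have : (δ : ℤ) < e := by rw [he]; nlinarith [mul_nonneg (Int.natCast_nonneg k) (Int.natCast_nonneg δ)]
    push_cast
    have hγ : (0 : ℤ) ≤ γ := Int.natCast_nonneg γ
    nlinarith
  have hu : IsUnit (C ((δ * γ - e * (γ + α : ℕ) : ℤ) : ℂ) : Poly) :=
    (isUnit_iff_ne_zero.2 (Int.cast_ne_zero.2 hne)).map C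
  rcases hπ.dvd_or_dvd hdvd with h4 | h4
  · exact hπ.not_isUnit (isUnit_of_dvd_unit h4 hu)
  · rcases hπ.dvd_or_dvd h4 with h5 | h5
    · rcases hπ.dvd_or_dvd h5 with h6 | h6
      · exact hi h6
      · exact (hπ.dvd_or_dvd h6).elim hg' hA'
    · exact (hπ.dvd_or_dvd h5).elim hg' hπB

/-- The rational solution of `[R, H] = R` is a polynomial. -/
theorem exists_bracket_eq_C_mul {δ : ℕ} {c : ℂ} (hδ : 0 < δ) (hρσ : 0 < ρ + σ)
    (hR : IsHom ρ σ δ R) (hR0 : R ≠ 0) (hc : c ≠ 0) (k : ℕ) :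
    ∀ (G : Poly) (e : ℤ), IsHom ρ σ e G → bracket R G = C c * R ^ (k + 1) →
      ∃ H, IsHom ρ σ (ρ + σ) H ∧ bracket R H = C c * R := by
  induction k with
  | zero =>
    intro G e hG h
    rw [zero_add, pow_one] at h
    have h1 := hR.isHom_bracket hG
    rw [h] at h1
    have h2 := (hR.C_mul c).unique h1 (mul_ne_zero (by simpa using hc) hR0)
    obtain rfl : e = ρ + σ := by linarith
    exact ⟨G, hG, h⟩
  | succ k ih =>
    intro G e hG h
    obtain ⟨G', rfl⟩ := dvd_of_bracket_eq_pow hδ hρσ hR hR0 hG hc h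
    refine ih G' _ (hR.of_mul_left hR0 hG) ?_
    rw [bracket_mul_right, bracket_self, zero_mul, zero_add] at h
    apply mul_left_cancel₀ hR0
    rw [h]; ring

/-- Modulo R, the derivation H ∂_i preserves the ideal of R. Thus from R ∣ H^j T one may pass to R ∣
H^(j+1) ∂_i T. Starting at T = R and differentiating down to a nonzero constant leaves R ∣ H^N. -/
theorem dvd_pow_of_dvd_mul_pderiv (hR0 : R ≠ 0) (h : ∀ i : Fin 2, R ∣ H * pderiv i R) :
    ∃ N, R ∣ H ^ N := by
  have step : ∀ (T : Poly) (j : ℕ) (i : Fin 2), R ∣ H ^ j * T → R ∣ H ^ (j + 1) * pderiv i T := by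
    intro T j i hT
    obtain ⟨S, hS⟩ := hT
    have h1 := congrArg (fun P => H * pderiv i P) hS
    simp only [pderiv_mul] at h1
    have h2 := mul_pderiv_pow_mul i H 1 j
    simp only [mul_one, pderiv_one, mul_zero, add_zero] at h2
    obtain ⟨S', hS'⟩ := h i
    refine ⟨S' * S + H * pderiv i S - j * pderiv i H * S, ?_⟩
    linear_combination h1 - T * h2 + S * hS' - j * pderiv i H * hS
  have main : ∀ (n : ℕ) (T : Poly) (j : ℕ), T ≠ 0 → T.totalDegree ≤ n → R ∣ H ^ j * T →
      ∃ N, R ∣ H ^ N := by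
    intro n
    induction n with
    | zero =>
      intro T j hT hn hd
      rw [totalDegree_eq_zero_iff_eq_C.1 (Nat.le_zero.1 hn)] at hd hT
      have hc : coeff 0 T ≠ 0 := by simpa using hT
      exact ⟨j, ((isUnit_iff_ne_zero.2 hc).map C).dvd_mul_right.1 hd⟩
    | succ n ih =>
      intro T j hT hn hd
      by_cases hT' : ∃ i : Fin 2, pderiv i T ≠ 0
      · obtain ⟨i, hi⟩ := hT'
        have := totalDegree_pderiv_lt hi
        exact ih _ _ hi (by omega) (step T j i hd)
      · push Not at hT'
        obtain ⟨c, rfl⟩ := eq_C_of_pderiv_eq_zero (hT' 0) (hT' 1)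
        exact ih _ j hT (by simp) hd
  exact main _ R 0 hR0 le_rfl (by simp)

/-- A pair with nonzero constant Jacobian. -/
def JacPair (F G : Poly) : Prop := ∃ c : ℂ, c ≠ 0 ∧ bracket F G = C c

/-- The leading parts of a Jacobian pair are powers of a common homogeneous polynomial `R`, and
there is a homogeneous `H` with `[R, H] = c R`. -/
theorem exists_leading_root {a b δ : ℕ} {F G : Poly} (ha : 0 < a) (hb : 0 < b)
    (hab : Nat.Coprime a b) (hJ : JacPair F G) (hρσ : 0 < ρ + σ) (hδ : 0 < δ)
    (hsum : ρ + σ < (a + b) * δ) (hF : DegLE ρ σ (a * δ) F) (hG : DegLE ρ σ (b * δ) G)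
    (hF0 : part ρ σ (a * δ) F ≠ 0) (hG0 : part ρ σ (b * δ) G ≠ 0) :
    ∃ (R H : Poly) (c c' : ℂ) (N : ℕ), IsHom ρ σ δ R ∧ part ρ σ (a * δ) F = R ^ a ∧
      c' ≠ 0 ∧ part ρ σ (b * δ) G = C c' * R ^ b ∧ IsHom ρ σ (ρ + σ) H ∧ c ≠ 0 ∧
      bracket R H = C c * R ∧ R ∣ H ^ N := by
  obtain ⟨c, hc, hJ⟩ := hJ
  have hδ' : (0 : ℤ) < δ := by exact_mod_cast hδ
  have hcomm : bracket (part ρ σ (a * δ) F) (part ρ σ (b * δ) G) = 0 := by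
    rw [← part_bracket hF hG, hJ]
    exact (isHom_C ρ σ c).degLE.part_eq_zero (by linarith)
  obtain ⟨c₁, hc₁, h1⟩ := (isHom_part ρ σ (a * δ) F).exists_pow_eq (isHom_part ρ σ (b * δ) G)
    (by positivity) hF0 hG0 hcomm a b (by ring)
  obtain ⟨R, c', hFR, hc', hGR⟩ := exists_root_of_pow_eq ha hab hb hF0 hc₁ h1
  have hR0 : R ≠ 0 := by rintro rfl; rw [zero_pow ha.ne'] at hFR; exact hF0 hFR
  have hR : IsHom ρ σ δ R := IsHom.of_pow ha.ne' hR0 (hFR ▸ isHom_part _ _ _ _)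
  -- The descent starts from Q = G and J = c in weight j = 0; a constant commutes with R.
  obtain ⟨E, e, k, c₂, hE, hc₂, hRE⟩ := exists_bracket_eq_pow hδ ha hR hR0 hF hFR
    (a * δ + b * δ - (ρ + σ) - 0).toNat G (C c) (b * δ) 0 hG (by rw [hJ]; exact (isHom_C _ _ c).degLE)
    (by rw [hJ]; exact (isHom_C _ _ c).part_eq) (by simpa using hc) (by simp [bracket])
    (by omega)
  obtain ⟨H, hH, hRH⟩ := exists_bracket_eq_C_mul hδ hρσ hR hR0 hc₂ k E e hE hRE
  obtain ⟨N, hN⟩ := dvd_pow_of_dvd_mul_pderiv (R := R) (H := H) hR0 (by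
    intro i
    obtain ⟨T, hT⟩ := hR.exists_euler_bracket hH i
    have hu : IsUnit (C ((ρ + σ : ℤ) : ℂ) : Poly) :=
      (isUnit_iff_ne_zero.2 (Int.cast_ne_zero.2 hρσ.ne')).map C
    rw [← hu.dvd_mul_left]
    refine ⟨C ((δ : ℤ) : ℂ) * pderiv i H - T * C c₂, ?_⟩
    rw [hRH] at hT
    linear_combination -hT)
  exact ⟨R, H, c₂, c', N, hR, hFR, hc', hGR, hH, hc₂, hRH, hN⟩

end

/-! ### Monomials, corners and rotation of the weight -/

section

variable {ρ σ D E : ℤ} {f g P Q R H : Poly} {a b p q : ℕ} {F G : Poly}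

/-- The exponent vector `(i, j)`. -/
def expo (i j : ℕ) : Fin 2 →₀ ℕ := Finsupp.single 0 i + Finsupp.single 1 j

@[simp] theorem expo_zero (i j : ℕ) : expo i j 0 = i := by simp [expo]

@[simp] theorem expo_one (i j : ℕ) : expo i j 1 = j := by simp [expo]

theorem eq_expo_iff {d : Fin 2 →₀ ℕ} {i j : ℕ} : d = expo i j ↔ d 0 = i ∧ d 1 = j := by
  constructor
  · rintro rfl; simp
  · rintro ⟨rfl, rfl⟩
    ext k; fin_cases k <;> simp

theorem wdeg_expo (ρ σ : ℤ) (i j : ℕ) : wdeg ρ σ (expo i j) = ρ * i + σ * j := by simp [wdeg]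

theorem monomial_expo (i j : ℕ) (c : ℂ) :
    (monomial (expo i j) c : Poly) = C c * (X 0 ^ i * X 1 ^ j) := by
  rw [X_pow_eq_monomial, X_pow_eq_monomial, monomial_mul, C_mul_monomial, expo]
  simp

theorem eq_monomial_of_support {e : Fin 2 →₀ ℕ} (h : ∀ d ∈ f.support, d = e) :
    f = monomial e (coeff e f) := by
  ext d
  rw [coeff_monomial]
  split_ifs with hd
  · rw [hd]
  · by_contra hc
    exact hd (h d (mem_support_iff.2 hc)).symm

theorem X_dvd_of_forall {i : Fin 2} (h : ∀ d ∈ f.support, d i ≠ 0) : (X i : Poly) ∣ f := by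
  rw [f.as_sum]
  exact Finset.dvd_sum fun d hd => X_dvd_monomial.2 (Or.inr (h d hd))

theorem ne_zero_of_X_dvd {i : Fin 2} (h : (X i : Poly) ∣ f) : ∀ d ∈ f.support, d i ≠ 0 := by
  classical
  obtain ⟨g, rfl⟩ := h
  intro d hd
  rw [mem_support_iff, coeff_X_mul'] at hd
  split_ifs at hd with h1
  · exact Finsupp.mem_support_iff.1 h1
  · exact absurd rfl hd

theorem X_mul_X_mul_bracket_monomial (d e : Fin 2 →₀ ℕ) (r h : ℂ) :
    X 0 * X 1 * bracket (monomial d r) (monomial e h) =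
      C ((d 0 : ℂ) * e 1 - e 0 * d 1) * (monomial d r * monomial e h) := by
  have h1 := fun i : Fin 2 => X_mul_pderiv_monomial (R := ℂ) (i := i) (m := d) (r := r)
  have h2 := fun i : Fin 2 => X_mul_pderiv_monomial (R := ℂ) (i := i) (m := e) (r := h)
  simp only [nsmul_eq_mul] at h1 h2
  simp only [bracket, map_sub, map_mul, map_natCast]
  linear_combination X 1 * pderiv 1 (monomial e h) * h1 0 + d 0 * monomial d r * h2 1 -
    X 1 * pderiv 1 (monomial d r) * h2 0 - e 0 * monomial e h * h1 1

/-- The bracket of two monomials carries the determinant of their exponent vectors as a factor. -/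
theorem bracket_monomial_ne_zero {d e : Fin 2 →₀ ℕ} {r h : ℂ} (hr : r ≠ 0) (hh : h ≠ 0)
    (hde : (d 0 : ℤ) * e 1 ≠ e 0 * d 1) : bracket (monomial d r) (monomial e h) ≠ 0 := by
  intro h0
  have h1 := X_mul_X_mul_bracket_monomial d e r h
  rw [h0, mul_zero] at h1
  have h2 : ((d 0 : ℂ) * e 1 - e 0 * d 1) ≠ 0 := by
    rw [sub_ne_zero]
    exact_mod_cast hde
  refine mul_ne_zero (a := (C ((d 0 : ℂ) * e 1 - e 0 * d 1) : Poly)) (by rw [Ne, C_eq_zero]; exact h2)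
    (mul_ne_zero ?_ ?_) h1.symm <;> simpa

theorem exists_monomial_of_dvd_pow {e : Fin 2 →₀ ℕ} {t : ℂ} {N : ℕ} (ht : t ≠ 0)
    (h : R ∣ monomial e t ^ N) : ∃ d r, R = monomial d r := by
  rw [monomial_pow, dvd_monomial_iff_exists (pow_ne_zero _ ht)] at h
  obtain ⟨d, r, -, -, h⟩ := h
  exact ⟨d, r, h⟩

/-- The data attached to the leading parts of a Jacobian pair. -/
structure EdgeData (ρ σ δ : ℤ) (a b : ℕ) (F G R H : Poly) : Prop where
  isHom : IsHom ρ σ δ R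
  ne_zero : R ≠ 0
  left : part ρ σ (a * δ) F = R ^ a
  right : ∃ c, c ≠ 0 ∧ part ρ σ (b * δ) G = C c * R ^ b
  isHom' : IsHom ρ σ (ρ + σ) H
  bracket_eq : ∃ c, c ≠ 0 ∧ bracket R H = C c * R
  dvd : ∃ N, R ∣ H ^ N

theorem EdgeData.ne_zero' {δ : ℤ} (h : EdgeData ρ σ δ a b F G R H) : H ≠ 0 := by
  rintro rfl
  obtain ⟨c, hc, h1⟩ := h.bracket_eq
  rw [bracket_zero_right] at h1
  exact mul_ne_zero (by simpa using hc) h.ne_zero h1.symm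

theorem exists_edgeData {δ : ℤ} (ha : 0 < a) (hb : 0 < b) (hab : Nat.Coprime a b)
    (hJ : JacPair F G) (hρσ : 0 < ρ + σ) (hδ : 0 < δ) (hsum : ρ + σ < (a + b) * δ)
    (hF : DegLE ρ σ (a * δ) F) (hG : DegLE ρ σ (b * δ) G)
    (hF0 : part ρ σ (a * δ) F ≠ 0) (hG0 : part ρ σ (b * δ) G ≠ 0) :
    ∃ R H, EdgeData ρ σ δ a b F G R H := by
  lift δ to ℕ using hδ.le
  obtain ⟨R, H, c, c', N, h1, h2, h3, h4, h5, h6, h7, h8⟩ :=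
    exists_leading_root ha hb hab hJ hρσ (by exact_mod_cast hδ) hsum hF hG hF0 hG0
  have hR0 : R ≠ 0 := by rintro rfl; rw [zero_pow ha.ne'] at h2; exact hF0 h2
  exact ⟨R, H, h1, hR0, h2, ⟨c', h3, h4⟩, h5, ⟨c, h6, h7⟩, ⟨N, h8⟩⟩

/-- The points `a (p, q)` and `b (p, q)` lie in the supports. -/
structure Corner (a b p q : ℕ) (F G : Poly) : Prop where
  jac : JacPair F G
  left : coeff (expo (a * p) (a * q)) F ≠ 0
  right : coeff (expo (b * p) (b * q)) G ≠ 0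

/-- The corner has maximal weight. -/
def Dominates (ρ σ : ℤ) (a b p q : ℕ) (F G : Poly) : Prop :=
  DegLE ρ σ (a * (ρ * p + σ * q)) F ∧ DegLE ρ σ (b * (ρ * p + σ * q)) G

/-- The corner is the only point of maximal weight. -/
def StrictlyDominates (ρ σ : ℤ) (a b p q : ℕ) (F G : Poly) : Prop :=
  (∀ d ∈ F.support, d ≠ expo (a * p) (a * q) → wdeg ρ σ d < a * (ρ * p + σ * q)) ∧
  (∀ d ∈ G.support, d ≠ expo (b * p) (b * q) → wdeg ρ σ d < b * (ρ * p + σ * q))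

theorem wdeg_corner (ρ σ : ℤ) (a p q : ℕ) :
    wdeg ρ σ (expo (a * p) (a * q)) = a * (ρ * p + σ * q) := by
  rw [wdeg_expo]; push_cast; ring

theorem StrictlyDominates.dominates (h : StrictlyDominates ρ σ a b p q F G) :
    Dominates ρ σ a b p q F G := by
  constructor
  · intro d hd
    by_cases hd' : d = expo (a * p) (a * q)
    · rw [hd', wdeg_corner]
    · exact (h.1 d hd hd').le
  · intro d hd
    by_cases hd' : d = expo (b * p) (b * q)
    · rw [hd', wdeg_corner]
    · exact (h.2 d hd hd').le

theorem Corner.part_left_ne_zero (hc : Corner a b p q F G) (ρ σ : ℤ) :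
    part ρ σ (a * (ρ * p + σ * q)) F ≠ 0 := by
  intro h
  have h1 := coeff_part ρ σ (a * (ρ * p + σ * q)) F (expo (a * p) (a * q))
  rw [h, if_pos (wdeg_corner _ _ _ _ _), coeff_zero] at h1
  exact hc.left h1.symm

theorem Corner.part_right_ne_zero (hc : Corner a b p q F G) (ρ σ : ℤ) :
    part ρ σ (b * (ρ * p + σ * q)) G ≠ 0 := by
  intro h
  have h1 := coeff_part ρ σ (b * (ρ * p + σ * q)) G (expo (b * p) (b * q))
  rw [h, if_pos (wdeg_corner _ _ _ _ _), coeff_zero] at h1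
  exact hc.right h1.symm

theorem strict_of_part_monomial {f : Poly} {n : ℕ} {δ : ℤ} {d₀ : Fin 2 →₀ ℕ} {t : ℂ}
    (hle : DegLE ρ σ (n * (ρ * p + σ * q)) f) (hc : coeff (expo (n * p) (n * q)) f ≠ 0)
    (hδ : δ = ρ * p + σ * q) (hf : part ρ σ (n * δ) f = monomial d₀ t) :
    ∀ d ∈ f.support, d ≠ expo (n * p) (n * q) → wdeg ρ σ d < n * (ρ * p + σ * q) := by
  classical
  subst hδ
  have key : ∀ d ∈ f.support, wdeg ρ σ d = n * (ρ * p + σ * q) → d = d₀ := by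
    intro d hd hw
    have h1 := coeff_part ρ σ (n * (ρ * p + σ * q)) f d
    rw [hf, if_pos hw, coeff_monomial] at h1
    by_contra hne
    rw [if_neg (Ne.symm hne)] at h1
    exact mem_support_iff.1 hd h1.symm
  intro d hd hne
  refine lt_of_le_of_ne (hle d hd) fun hw => hne ?_
  rw [key d hd hw, key _ (mem_support_iff.2 hc) (wdeg_corner _ _ _ _ _)]

theorem EdgeData.exists_monomial {δ : ℤ} (h : EdgeData ρ σ δ a b F G R H)
    (hH : ∃ e t, H = monomial e t) : ∃ d r, R = monomial d r := by
  obtain ⟨e, t, rfl⟩ := hH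
  obtain ⟨N, hN⟩ := h.dvd
  have ht : t ≠ 0 := by rintro rfl; exact h.ne_zero' (by simp)
  exact exists_monomial_of_dvd_pow ht hN

theorem EdgeData.strictlyDominates {δ : ℤ} (h : EdgeData ρ σ δ a b F G R H)
    (hc : Corner a b p q F G) (hδ : δ = ρ * p + σ * q) (hD : Dominates ρ σ a b p q F G)
    (hR : ∃ e t, R = monomial e t) : StrictlyDominates ρ σ a b p q F G := by
  obtain ⟨d, r, rfl⟩ := hR
  have h1 := h.left
  obtain ⟨c, -, h2⟩ := h.right
  rw [monomial_pow] at h1 h2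
  rw [C_mul_monomial] at h2
  exact ⟨strict_of_part_monomial hD.1 hc.left hδ h1, strict_of_part_monomial hD.2 hc.right hδ h2⟩

/-- If the polynomial `H` attached to any leading part is a monomial, there is no edge. -/
theorem strictlyDominates_of_monomial (ha : 0 < a) (hb : 0 < b) (hab : Nat.Coprime a b)
    (hc : Corner a b p q F G) (hD : Dominates ρ σ a b p q F G) (hρσ : 0 < ρ + σ)
    (hδ : 0 < ρ * p + σ * q) (hsum : ρ + σ < (a + b) * (ρ * p + σ * q))
    (hH : ∀ R H, EdgeData ρ σ (ρ * p + σ * q) a b F G R H → ∃ e t, H = monomial e t) :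
    StrictlyDominates ρ σ a b p q F G := by
  obtain ⟨R, H, h⟩ := exists_edgeData ha hb hab hc.jac hρσ hδ hsum hD.1 hD.2
    (hc.part_left_ne_zero ρ σ) (hc.part_right_ne_zero ρ σ)
  exact h.strictlyDominates hc rfl hD (h.exists_monomial (hH R H h))

/-- Rotating a functional from the first coordinate towards the second, the first nonzero point of S
that it meets would produce an edge through the origin. -/
theorem snd_nonpos_of_no_crossing (S : Finset (ℤ × ℤ)) (h0 : ∀ s ∈ S, s ≠ 0 → s.1 < 0)
    (hedge : ∀ α β : ℤ, 0 < α → 0 < β → (∀ s ∈ S, α * s.1 + β * s.2 ≤ 0) →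
      ∀ s ∈ S, s ≠ 0 → α * s.1 + β * s.2 < 0) : ∀ s ∈ S, s.2 ≤ 0 := by
  intro s₁ hs₁
  by_contra hpos
  push Not at hpos
  obtain ⟨s, hs, hmax⟩ := (S.filter fun s => 0 < s.2).exists_max_image
    (fun s => (s.2 : ℚ) / (-s.1)) ⟨s₁, Finset.mem_filter.2 ⟨hs₁, hpos⟩⟩
  obtain ⟨hsS, hs2⟩ := Finset.mem_filter.1 hs
  have hs0 : s ≠ 0 := by rintro rfl; simp at hs2
  have hs1 := h0 s hsS hs0
  -- This functional vanishes at s, and is nonpositive on S because s maximises the slope.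
  have := hedge s.2 (-s.1) hs2 (by omega) (by
    intro t ht
    by_cases ht0 : t = 0
    · subst ht0; simp
    have ht1 := h0 t ht ht0
    by_cases ht2 : 0 < t.2
    · have h1 := hmax t (Finset.mem_filter.2 ⟨ht, ht2⟩)
      have e1 : (0 : ℚ) < -(t.1 : ℚ) := by exact_mod_cast (by omega : 0 < -t.1)
      have e2 : (0 : ℚ) < -(s.1 : ℚ) := by exact_mod_cast (by omega : 0 < -s.1)
      rw [div_le_div_iff₀ e1 e2] at h1
      have h2 : t.2 * (-s.1) ≤ s.2 * (-t.1) := by exact_mod_cast h1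
      linarith
    · push Not at ht2
      nlinarith) s hsS hs0
  linarith

/-- Both supports are translated to put their corners at the origin, and their points are measured
by the two weights; the planar statement then applies to the union. -/
theorem dominates_of_no_edge {ρ₀ σ₀ ρ₁ σ₁ : ℤ} (h0 : StrictlyDominates ρ₀ σ₀ a b p q F G)
    (hedge : ∀ α β : ℤ, 0 < α → 0 < β →
      Dominates (α * ρ₀ + β * ρ₁) (α * σ₀ + β * σ₁) a b p q F G →
      StrictlyDominates (α * ρ₀ + β * ρ₁) (α * σ₀ + β * σ₁) a b p q F G) :
    Dominates ρ₁ σ₁ a b p q F G := by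
  classical
  let φ : ℕ → (Fin 2 →₀ ℕ) → ℤ × ℤ := fun n d =>
    (wdeg ρ₀ σ₀ d - n * (ρ₀ * p + σ₀ * q), wdeg ρ₁ σ₁ d - n * (ρ₁ * p + σ₁ * q))
  have hφ : ∀ n d, φ n d ≠ 0 → d ≠ expo (n * p) (n * q) := by
    rintro n d hd rfl
    exact hd (by simp only [φ, wdeg_corner, sub_self]; rfl)
  have hcomb : ∀ (α β : ℤ) n d, α * (φ n d).1 + β * (φ n d).2 =
      wdeg (α * ρ₀ + β * ρ₁) (α * σ₀ + β * σ₁) d -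
        n * ((α * ρ₀ + β * ρ₁) * p + (α * σ₀ + β * σ₁) * q) := by
    intro α β n d
    simp only [φ, wdeg]; ring
  have key := snd_nonpos_of_no_crossing (F.support.image (φ a) ∪ G.support.image (φ b)) (by
      intro s hs hs0
      rcases Finset.mem_union.1 hs with hs | hs <;> obtain ⟨d, hd, rfl⟩ := Finset.mem_image.1 hs
      · exact sub_neg.2 (h0.1 d hd (hφ _ _ hs0))
      · exact sub_neg.2 (h0.2 d hd (hφ _ _ hs0))) (by
      intro α β hα hβ hle s hs hs0
      have hdom := hedge α β hα hβ ⟨fun d hd => by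
          have := hle (φ a d) (Finset.mem_union_left _ (Finset.mem_image_of_mem _ hd))
          rw [hcomb] at this
          linarith, fun d hd => by
          have := hle (φ b d) (Finset.mem_union_right _ (Finset.mem_image_of_mem _ hd))
          rw [hcomb] at this
          linarith⟩
      rcases Finset.mem_union.1 hs with hs | hs <;> obtain ⟨d, hd, rfl⟩ := Finset.mem_image.1 hs
      · rw [hcomb]; exact sub_neg.2 (hdom.1 d hd (hφ _ _ hs0))
      · rw [hcomb]; exact sub_neg.2 (hdom.2 d hd (hφ _ _ hs0)))
  constructor
  · intro d hd
    have := key (φ a d) (Finset.mem_union_left _ (Finset.mem_image_of_mem _ hd))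
    simp only [φ] at this
    linarith
  · intro d hd
    have := key (φ b d) (Finset.mem_union_right _ (Finset.mem_image_of_mem _ hd))
    simp only [φ] at this
    linarith

end

/-! ### Directions without edges -/

section

variable {ρ σ D E δ : ℤ} {f g P Q R H : Poly} {a b p q : ℕ} {F G : Poly}

theorem exists_eq_monomial_expo {i j : ℕ} (h : ∀ d ∈ f.support, d 0 = i ∧ d 1 = j) :
    ∃ e t, f = monomial e t :=
  ⟨_, _, eq_monomial_of_support fun d hd => eq_expo_iff.2 (h d hd)⟩

theorem X_dvd_of_dvd_pow {i : Fin 2} {n : ℕ} (h : (X i : Poly) ∣ f ^ n) : (X i : Poly) ∣ f :=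
  X_prime.dvd_of_dvd_pow h

theorem EdgeData.X_dvd {i : Fin 2} (h : EdgeData ρ σ δ a b F G R H)
    (hF : ∀ d ∈ F.support, wdeg ρ σ d = a * δ → d i ≠ 0) : (X i : Poly) ∣ H := by
  have h1 : (X i : Poly) ∣ R ^ a := by
    rw [← h.left]
    refine X_dvd_of_forall fun d hd => ?_
    have hw := isHom_part _ _ _ _ d hd
    rw [mem_support_iff, coeff_part, if_pos hw] at hd
    exact hF d (mem_support_iff.2 hd) hw
  obtain ⟨N, hN⟩ := h.dvd
  exact X_dvd_of_dvd_pow ((X_dvd_of_dvd_pow h1).trans hN)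

theorem IsHom.exists_monomial_of_X_zero_dvd (hH : IsHom ρ σ (ρ + σ) H) (hσ : 0 < σ) (hρ : σ ≤ ρ)
    (hd : (X 0 : Poly) ∣ H) (hd' : σ = ρ → (X 1 : Poly) ∣ H) : ∃ e t, H = monomial e t := by
  refine exists_eq_monomial_expo (i := 1) (j := 1) fun d hdH => ?_
  have h0 := ne_zero_of_X_dvd hd d hdH
  have h1 := hH d hdH
  simp only [wdeg] at h1
  have h2 : (1 : ℤ) ≤ d 0 := by omega
  have h3 : (0 : ℤ) ≤ d 1 := by omega
  have h4 : d 0 = 1 := by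
    by_contra hne
    have h5 : (2 : ℤ) ≤ d 0 := by omega
    rcases hρ.lt_or_eq with hlt | heq
    · nlinarith [mul_nonneg hσ.le h3]
    · have h6 := ne_zero_of_X_dvd (hd' heq) d hdH
      have h7 : (1 : ℤ) ≤ d 1 := by omega
      nlinarith
  refine ⟨h4, ?_⟩
  rw [h4] at h1
  have : σ * (d 1 : ℤ) = σ * 1 := by push_cast at h1; linarith
  exact_mod_cast mul_left_cancel₀ hσ.ne' this

theorem IsHom.exists_monomial_of_X_one_dvd (hH : IsHom ρ σ (ρ + σ) H) (hρ : 0 < ρ) (hσ : ρ < σ)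
    (hd : (X 1 : Poly) ∣ H) : ∃ e t, H = monomial e t := by
  refine exists_eq_monomial_expo (i := 1) (j := 1) fun d hdH => ?_
  have h0 := ne_zero_of_X_dvd hd d hdH
  have h1 := hH d hdH
  simp only [wdeg] at h1
  have h2 : (1 : ℤ) ≤ d 1 := by omega
  have h3 : (0 : ℤ) ≤ d 0 := by omega
  have h4 : d 1 = 1 := by
    by_contra hne
    have h5 : (2 : ℤ) ≤ d 1 := by omega
    nlinarith [mul_nonneg hρ.le h3]
  refine ⟨?_, h4⟩
  rw [h4] at h1
  have : ρ * (d 0 : ℤ) = ρ * 1 := by push_cast at h1; linarith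
  exact_mod_cast mul_left_cancel₀ hρ.ne' this

/-- On the line ρi + σj = ρ + σ, i ≥ 2 is too heavy and i = 0 would need σ ∣ ρ, so only (1, 1)
remains. -/
theorem IsHom.exists_monomial_of_not_dvd (hH : IsHom ρ σ (ρ + σ) H) (hσ : 0 < σ) (hρ : σ < ρ)
    (hd : ¬ σ ∣ ρ) : ∃ e t, H = monomial e t := by
  refine exists_eq_monomial_expo (i := 1) (j := 1) fun d hdH => ?_
  have h1 := hH d hdH
  simp only [wdeg] at h1
  have h3 : (0 : ℤ) ≤ d 1 := by omega
  have h4 : d 0 = 1 := by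
    by_contra hne
    rcases Nat.eq_zero_or_pos (d 0) with h0 | h0
    · rw [h0] at h1
      refine hd ⟨d 1 - 1, ?_⟩
      push_cast at h1
      linarith
    · have h5 : (2 : ℤ) ≤ d 0 := by omega
      nlinarith [mul_nonneg hσ.le h3]
  refine ⟨h4, ?_⟩
  rw [h4] at h1
  have : σ * (d 1 : ℤ) = σ * 1 := by push_cast at h1; linarith
  exact_mod_cast mul_left_cancel₀ hσ.ne' this

/-- In the intermediate directions (α + β, α), an edge can only leave the corner towards larger
x-exponents. Hence x divides the leading part and so H, which forces H to be a multiple of xy by a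
constant. -/
theorem Corner.dominates_one_zero (ha : 2 ≤ a) (hab : a < b) (hcop : Nat.Coprime a b)
    (hc : Corner a b p q F G) (hp : 0 < p) (h0 : StrictlyDominates 1 1 a b p q F G) :
    Dominates 1 0 a b p q F G := by
  refine dominates_of_no_edge h0 fun α β hα hβ hD => ?_
  have hp' : (1 : ℤ) ≤ p := by omega
  have hq' : (0 : ℤ) ≤ q := by omega
  have ha' : (2 : ℤ) ≤ a := by omega
  have hb' : (3 : ℤ) ≤ b := by omega
  simp only [mul_one, mul_zero, add_zero] at hD ⊢
  have hδ : α + β ≤ (α + β) * p + α * q := by nlinarith [mul_nonneg hα.le hq']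
  refine strictlyDominates_of_monomial (by omega) (by omega) hcop hc hD (by linarith)
    (by linarith) (by nlinarith) fun R H h => ?_
  refine h.isHom'.exists_monomial_of_X_zero_dvd hα (by linarith) (h.X_dvd fun d hd hw => ?_)
    fun h => by omega
  have h1 := h0.dominates.1 d hd
  simp only [wdeg] at h1 hw
  have h2 : β * (d 0 - a * p) ≥ 0 := by nlinarith
  have h3 : (0 : ℤ) ≤ d 0 - a * p := nonneg_of_mul_nonneg_right h2 hβ
  have h4 : (0 : ℤ) < a * p := by positivity
  omega

theorem Corner.dominates_zero_one (ha : 2 ≤ a) (hab : a < b) (hcop : Nat.Coprime a b)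
    (hc : Corner a b p q F G) (hq : 0 < q) (h0 : StrictlyDominates 1 1 a b p q F G) :
    Dominates 0 1 a b p q F G := by
  refine dominates_of_no_edge h0 fun α β hα hβ hD => ?_
  have hq' : (1 : ℤ) ≤ q := by omega
  have hp' : (0 : ℤ) ≤ p := by omega
  have ha' : (2 : ℤ) ≤ a := by omega
  have hb' : (3 : ℤ) ≤ b := by omega
  simp only [mul_one, mul_zero, add_zero] at hD ⊢
  have hδ : α + β ≤ α * p + (α + β) * q := by nlinarith [mul_nonneg hα.le hp']
  refine strictlyDominates_of_monomial (by omega) (by omega) hcop hc hD (by linarith)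
    (by linarith) (by nlinarith) fun R H h => ?_
  refine h.isHom'.exists_monomial_of_X_one_dvd hα (by linarith) (h.X_dvd fun d hd hw => ?_)
  have h1 := h0.dominates.1 d hd
  simp only [wdeg] at h1 hw
  have h2 : β * (d 1 - a * q) ≥ 0 := by nlinarith
  have h3 : (0 : ℤ) ≤ d 1 - a * q := nonneg_of_mul_nonneg_right h2 hβ
  have h4 : (0 : ℤ) < a * q := by positivity
  omega

/-- The intermediate directions have slope strictly between the integers k and k + 1, so the
divisibility needed for an edge fails. -/
theorem Corner.dominates_pred (ha : 2 ≤ a) (hab : a < b) (hcop : Nat.Coprime a b)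
    (hc : Corner a b p q F G) (hp : 0 < p) {k : ℤ} (hk : 1 ≤ k)
    (h0 : StrictlyDominates (k + 1) 1 a b p q F G) : Dominates k 1 a b p q F G := by
  refine dominates_of_no_edge h0 fun α β hα hβ hD => ?_
  have hp' : (1 : ℤ) ≤ p := by omega
  have hq' : (0 : ℤ) ≤ q := by omega
  have ha' : (2 : ℤ) ≤ a := by omega
  have hb' : (3 : ℤ) ≤ b := by omega
  simp only [mul_one] at hD ⊢
  have e : α * (k + 1) + β * k = (α + β) * k + α := by ring
  rw [e] at hD ⊢
  have hk' : α + β ≤ (α + β) * k := by nlinarith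
  have hδ : (α + β) * k + α ≤ ((α + β) * k + α) * p + (α + β) * q := by
    nlinarith [mul_nonneg (by linarith : 0 ≤ α + β) hq']
  refine strictlyDominates_of_monomial (by omega) (by omega) hcop hc hD (by linarith)
    (by linarith) (by nlinarith) fun R H h => ?_
  refine h.isHom'.exists_monomial_of_not_dvd (by linarith) (by linarith) fun hd => ?_
  have h2 := Int.le_of_dvd hα ((Int.dvd_add_right (dvd_mul_right _ _)).1 hd)
  linarith

theorem JacPair.exists_mem_support (hJ : JacPair F G) (i : Fin 2) :
    (∃ d ∈ F.support, d i ≠ 0) ∨ ∃ d ∈ G.support, d i ≠ 0 := by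
  by_contra h
  push Not at h
  have key : ∀ f : Poly, (∀ d ∈ f.support, d i = 0) → pderiv i f = 0 := by
    intro f hf
    by_contra hne
    obtain ⟨d, hd⟩ := support_nonempty.2 hne
    have := hf _ (mem_support_of_pderiv hd)
    simp at this
  have h1 := key F h.1
  have h2 := key G h.2
  obtain ⟨c, hc, hb⟩ := hJ
  refine hc (C_eq_zero.1 (hb.symm.trans ?_))
  fin_cases i
  · simp only [Fin.zero_eta] at h1 h2
    rw [bracket, h1, h2]; simp
  · simp only [Fin.mk_one] at h1 h2
    rw [bracket, h1, h2]; simp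

/-- A degree ratio other than `1 / n` forces the degrees to be large. -/
theorem JacPair.le_mul (hJ : JacPair F G) (hab : a ≤ b) (hρ : 0 ≤ ρ) (hσ : 0 ≤ σ) (hδ : 0 ≤ δ)
    (hF : DegLE ρ σ (a * δ) F) (hG : DegLE ρ σ (b * δ) G) : ρ ≤ b * δ := by
  have key : ∀ d : Fin 2 →₀ ℕ, d 0 ≠ 0 → ρ ≤ wdeg ρ σ d := by
    intro d hd
    have h1 : (1 : ℤ) ≤ d 0 := by omega
    have h2 : (0 : ℤ) ≤ d 1 := by omega
    simp only [wdeg]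
    nlinarith [mul_nonneg hσ h2]
  have hab' : (a : ℤ) ≤ b := by exact_mod_cast hab
  rcases hJ.exists_mem_support 0 with ⟨d, hd, h0⟩ | ⟨d, hd, h0⟩
  · have := (key d h0).trans (hF d hd)
    nlinarith
  · exact (key d h0).trans (hG d hd)

theorem Corner.dominates_succ (ha : 2 ≤ a) (hab : a < b) (hcop : Nat.Coprime a b)
    (hc : Corner a b 0 q F G) (hq : 0 < q) {k : ℤ} (hk : 1 ≤ k)
    (h0 : StrictlyDominates k 1 a b 0 q F G) : Dominates (k + 1) 1 a b 0 q F G := by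
  refine dominates_of_no_edge h0 fun α β hα hβ hD => ?_
  have hq' : (1 : ℤ) ≤ q := by omega
  have ha' : (2 : ℤ) ≤ a := by omega
  have hb' : (3 : ℤ) ≤ b := by omega
  simp only [mul_one] at hD ⊢
  have e : α * k + β * (k + 1) = (α + β) * k + β := by ring
  rw [e] at hD ⊢
  have hk' : α + β ≤ (α + β) * k := by nlinarith
  have hδ : (α + β) ≤ ((α + β) * k + β) * (0 : ℕ) + (α + β) * q := by
    push_cast; nlinarith
  -- For a corner on the y-axis the common degree does not grow with k; this bound on the x-weight
  -- supplies the inequality that makes the leading parts commute.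
  have hle := hc.jac.le_mul hab.le (by linarith) (by linarith) (by linarith) hD.1 hD.2
  refine strictlyDominates_of_monomial (by omega) (by omega) hcop hc hD (by linarith)
    (by linarith) (by nlinarith) fun R H h => ?_
  refine h.isHom'.exists_monomial_of_not_dvd (by linarith) (by linarith) fun hd => ?_
  have h2 := Int.le_of_dvd hβ ((Int.dvd_add_right (dvd_mul_right _ _)).1 hd)
  linarith

theorem exists_isMax_degree_zero (hf : f ≠ 0) :
    ∃ M : ℕ, DegLE 1 0 M f ∧ part 1 0 M f ≠ 0 := by
  obtain ⟨d, hd, hmax⟩ := f.support.exists_max_image (fun d => d 0) (support_nonempty.2 hf)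
  refine ⟨d 0, fun e he => ?_, fun h => ?_⟩
  · simp only [wdeg]
    have := hmax e he
    omega
  · have h1 := coeff_part 1 0 (d 0) f d
    rw [h, if_pos (by simp [wdeg]), coeff_zero] at h1
    exact mem_support_iff.1 hd h1.symm

/-- For weights `(-t, s)` with `0 ≤ t < s` the polynomial `H` is linear in `x`. -/
theorem EdgeData.degree_zero_le_one {t s : ℤ} (ha : 0 < a) (ht : 0 ≤ t) (hts : t < s)
    (h : EdgeData (-t) s (-t * p + s * q) a b F G R H) (hc : Corner a b p q F G)
    (hD : Dominates 1 0 a b p q F G) (hp : 0 < p) (hpq : p < q) :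
    ∀ d ∈ H.support, d 0 ≤ 1 := by
  have hs : 0 < s := by linarith
  have ha' : (0 : ℤ) < a := by omega
  -- the part of `R` of highest degree in `x` is the corner monomial
  have hpF : DegLE 1 0 (a * p) (R ^ a) := by
    rw [← h.left]
    intro d hd
    have hw := isHom_part _ _ _ _ d hd
    rw [mem_support_iff, coeff_part, if_pos hw] at hd
    have := hD.1 d (mem_support_iff.2 hd)
    simpa using this
  obtain ⟨M₀, hM₀, hM₀'⟩ := exists_isMax_degree_zero h.ne_zero
  have hM₀p : (M₀ : ℤ) ≤ p := by
    by_contra hlt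
    push Not at hlt
    have h1 := part_pow hM₀ a
    rw [hpF.part_eq_zero (by nlinarith)] at h1
    exact pow_ne_zero a hM₀' h1.symm
  have hRp : DegLE 1 0 p R := hM₀.mono hM₀p
  have hRt : part 1 0 p R ≠ 0 := by
    intro h0
    have h1 := part_pow hRp a
    rw [h0, zero_pow ha.ne', ← h.left] at h1
    have h2 := coeff_part 1 0 (a * p) (part (-t) s (a * (-t * p + s * q)) F)
      (expo (a * p) (a * q))
    rw [h1, if_pos (by rw [wdeg_expo]; push_cast; ring), coeff_part,
      if_pos (wdeg_corner _ _ _ _ _), coeff_zero] at h2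
    exact hc.left h2.symm
  have hRm : part 1 0 p R = monomial (expo p q) (coeff (expo p q) (part 1 0 p R)) := by
    refine eq_monomial_of_support fun d hd => ?_
    have hw := isHom_part _ _ _ _ d hd
    rw [mem_support_iff, coeff_part, if_pos hw] at hd
    have hw' := h.isHom d (mem_support_iff.2 hd)
    simp only [wdeg] at hw hw'
    have e0 : (d 0 : ℤ) = p := by linarith
    rw [e0] at hw'
    have e1 : s * (d 1 : ℤ) = s * q := by linarith
    have e2 := mul_left_cancel₀ hs.ne' e1
    exact eq_expo_iff.2 ⟨by exact_mod_cast e0, by exact_mod_cast e2⟩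
  obtain ⟨M, hM, hM'⟩ := exists_isMax_degree_zero h.ne_zero'
  suffices hM1 : M ≤ 1 by
    intro d hd
    have := hM d hd
    simp only [wdeg] at this
    omega
  by_contra hM2
  push Not at hM2
  obtain ⟨e, he⟩ := support_nonempty.2 hM'
  have hwe : ∀ d ∈ (part 1 0 M H).support, (d 0 : ℤ) = M ∧ -t * M + s * d 1 = -t + s := by
    intro d hd
    have hw := isHom_part _ _ _ _ d hd
    rw [mem_support_iff, coeff_part, if_pos hw] at hd
    have hw' := h.isHom' d (mem_support_iff.2 hd)
    simp only [wdeg] at hw hw'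
    have e0 : (d 0 : ℤ) = M := by linarith
    rw [e0] at hw'
    exact ⟨e0, hw'⟩
  obtain ⟨he0, he1⟩ := hwe e he
  have hHm : part 1 0 M H = monomial e (coeff e (part 1 0 M H)) := by
    refine eq_monomial_of_support fun d hd => ?_
    obtain ⟨h0, h1⟩ := hwe d hd
    have e1 : s * (d 1 : ℤ) = s * e 1 := by linarith
    have e2 := mul_left_cancel₀ hs.ne' e1
    ext i
    fin_cases i
    · show d 0 = e 0
      omega
    · show d 1 = e 1
      omega
  obtain ⟨c, hc0, hb⟩ := h.bracket_eq
  -- For M ≥ 2 the top parts in x would have bracket of x-degree p + M - 1 > p, whereas [R, H] = cR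
  -- has x-degree at most p. So the bracket of the two monomials vanishes and their exponents are
  -- proportional.
  have h1 := part_bracket hRp hM
  rw [hb, (hRp.C_mul c).part_eq_zero (by omega), hRm, hHm] at h1
  have hr : coeff (expo p q) (part 1 0 p R) ≠ 0 := by
    intro h0
    rw [h0, monomial_zero] at hRm
    exact hRt hRm
  refine bracket_monomial_ne_zero hr (mem_support_iff.1 he) ?_ h1.symm
  rw [expo_zero, expo_one, he0]
  intro hcontra
  -- `p L = q M` and `s L = s - t + t M`
  have hM2' : (2 : ℤ) ≤ M := by exact_mod_cast hM2
  have hpq' : (p : ℤ) + 1 ≤ q := by exact_mod_cast hpq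
  have hp' : (1 : ℤ) ≤ p := by exact_mod_cast hp
  have h2 : s * (M * q) = p * (s - t + t * M) := by
    rw [← hcontra]; linear_combination (p : ℤ) * he1
  have h3 : (s - t) ≤ (s - t) * M := by nlinarith
  have h4 : (p : ℤ) * (s - t + t * M) ≤ p * (s * M) := by
    apply mul_le_mul_of_nonneg_left _ (by linarith); linarith
  have h5 : (p : ℤ) * (s * M) < s * (M * q) := by
    have : 0 < s * M := by positivity
    nlinarith
  linarith

/-- For the weights (-β, α + β), H is at most linear in x. A term free of x would need (α + β)j = α,
which is impossible, so H is a multiple of xy. -/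
theorem Corner.dominates_neg_one_one (ha : 2 ≤ a) (hab : a < b) (hcop : Nat.Coprime a b)
    (hc : Corner a b p q F G) (hp : 0 < p) (hpq : p < q) (hD : Dominates 1 0 a b p q F G)
    (h0 : StrictlyDominates 0 1 a b p q F G) : Dominates (-1) 1 a b p q F G := by
  refine dominates_of_no_edge h0 fun α β hα hβ hD' => ?_
  have hp' : (1 : ℤ) ≤ p := by omega
  have hpq' : (p : ℤ) + 1 ≤ q := by omega
  have ha' : (2 : ℤ) ≤ a := by omega
  have hb' : (3 : ℤ) ≤ b := by omega
  have e : α * 0 + β * -1 = -β := by ring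
  simp only [mul_one, e] at hD' ⊢
  have hδ : α ≤ -β * p + (α + β) * q := by nlinarith
  refine strictlyDominates_of_monomial (by omega) (by omega) hcop hc hD' (by linarith)
    (by linarith) (by nlinarith) fun R H h => ?_
  refine exists_eq_monomial_expo (i := 1) (j := 1) fun d hd => ?_
  have h1 := h.degree_zero_le_one (by omega) hβ.le (by linarith) hc hD hp hpq d hd
  have h2 := h.isHom' d hd
  simp only [wdeg] at h2
  interval_cases hd0 : d 0
  · exfalso
    push_cast at h2
    have h3 : (α + β) * d 1 = α := by linarith
    rcases Nat.eq_zero_or_pos (d 1) with h4 | h4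
    · rw [h4] at h3; push_cast at h3; linarith
    · have : (1 : ℤ) ≤ d 1 := by omega
      nlinarith
  · refine ⟨rfl, ?_⟩
    push_cast at h2
    have h3 : (α + β) * (d 1 : ℤ) = (α + β) * 1 := by linarith
    exact_mod_cast mul_left_cancel₀ (by linarith) h3

end

/-! ### Homogeneous automorphisms -/

section

variable {ρ σ D E δ : ℤ} {f g P Q R H u v : Poly} {a b p q : ℕ} {F G : Poly}

/-- The substitution `x ↦ u`, `y ↦ v`. -/
def subst (u v : Poly) : Poly →ₐ[ℂ] Poly := aeval ![u, v]

@[simp] theorem subst_X_zero (u v : Poly) : subst u v (X 0) = u := by simp [subst]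

@[simp] theorem subst_X_one (u v : Poly) : subst u v (X 1) = v := by simp [subst]

@[simp] theorem subst_C (u v : Poly) (c : ℂ) : subst u v (C c) = C c := by
  simp only [subst, algHom_C, algebraMap_eq]

theorem subst_monomial (u v : Poly) (d : Fin 2 →₀ ℕ) (c : ℂ) :
    subst u v (monomial d c) = C c * (u ^ d 0 * v ^ d 1) := by
  rw [(eq_expo_iff (d := d)).2 ⟨rfl, rfl⟩, monomial_expo]
  simp

theorem pderiv_subst (i : Fin 2) (u v f : Poly) :
    pderiv i (subst u v f) =
      subst u v (pderiv 0 f) * pderiv i u + subst u v (pderiv 1 f) * pderiv i v := by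
  induction f using MvPolynomial.induction_on with
  | C c => simp
  | add p q hp hq => simp only [map_add, hp, hq]; ring
  | mul_X p j hp =>
    fin_cases j
    · simp only [Fin.zero_eta, map_mul, map_add, subst_X_zero, pderiv_mul, hp, pderiv_X_self,
        pderiv_X_of_ne (show (0 : Fin 2) ≠ 1 by decide), mul_one, mul_zero, add_zero]
      ring
    · simp only [Fin.mk_one, map_mul, map_add, subst_X_one, pderiv_mul, hp, pderiv_X_self,
        pderiv_X_of_ne (show (1 : Fin 2) ≠ 0 by decide), mul_one, mul_zero, add_zero]
      ring

theorem bracket_subst (u v f g : Poly) :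
    bracket (subst u v f) (subst u v g) = subst u v (bracket f g) * bracket u v := by
  simp only [bracket, pderiv_subst, map_sub, map_mul]
  ring

theorem DegLE.subst {ρ' σ' : ℤ} (hf : DegLE ρ σ D f) (hu : DegLE ρ' σ' ρ u)
    (hv : DegLE ρ' σ' σ v) : DegLE ρ' σ' D (subst u v f) := by
  rw [f.as_sum, map_sum]
  refine Finset.sum_induction _ (DegLE ρ' σ' D) (fun _ _ => DegLE.add) DegLE.zero fun d hd => ?_
  rw [subst_monomial]
  refine (((hu.pow _).mul (hv.pow _)).C_mul _).mono ?_
  have := hf d hd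
  simp only [wdeg] at this
  linarith

theorem IsHom.subst {ρ' σ' : ℤ} (hf : IsHom ρ σ D f) (hu : IsHom ρ' σ' ρ u)
    (hv : IsHom ρ' σ' σ v) : IsHom ρ' σ' D (subst u v f) := by
  rw [f.as_sum, map_sum]
  refine Finset.sum_induction _ (IsHom ρ' σ' D) (fun _ _ => IsHom.add) IsHom.zero fun d hd => ?_
  rw [subst_monomial]
  have := hf d hd
  simp only [wdeg] at this
  convert ((hu.pow _).mul (hv.pow _)).C_mul _ using 1
  linarith

theorem part_subst (hf : DegLE ρ σ D f) (hu : IsHom ρ σ ρ u) (hv : IsHom ρ σ σ v) :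
    part ρ σ D (subst u v f) = subst u v (part ρ σ D f) := by
  have e : subst u v f = subst u v (part ρ σ D f) + subst u v (f - part ρ σ D f) := by
    rw [← map_add]; congr 1; ring
  rw [e, map_add, (hf.sub_part.subst hu.degLE hv.degLE).part_eq_zero (by omega), add_zero,
    ((isHom_part ρ σ D f).subst hu hv).part_eq]

/-- A weighted homogeneous automorphism. -/
structure IsHomAut (ρ σ : ℤ) (u v : Poly) : Prop where
  left : IsHom ρ σ ρ u
  right : IsHom ρ σ σ v
  jac : JacPair u v
  inv : ∃ ψ : Poly →ₐ[ℂ] Poly, ψ u = X 0 ∧ ψ v = X 1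

theorem IsHomAut.injective (h : IsHomAut ρ σ u v) : Function.Injective (subst u v) := by
  obtain ⟨ψ, h0, h1⟩ := h.inv
  have : ψ.comp (subst u v) = AlgHom.id ℂ Poly := by
    apply algHom_ext
    intro i
    fin_cases i <;> simp [h0, h1]
  intro f g hfg
  have h2 := congrArg ψ hfg
  have h3 := fun f => DFunLike.congr_fun this f
  simp only [AlgHom.comp_apply, AlgHom.id_apply] at h3
  rwa [h3, h3] at h2

theorem IsHomAut.ne_zero (h : IsHomAut ρ σ u v) (hf : f ≠ 0) : subst u v f ≠ 0 := by
  rwa [Ne, map_eq_zero_iff _ h.injective]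

theorem JacPair.subst (hJ : JacPair F G) (h : JacPair u v) :
    JacPair (subst u v F) (subst u v G) := by
  obtain ⟨c, hc, hb⟩ := hJ
  obtain ⟨j, hj, hb'⟩ := h
  exact ⟨c * j, mul_ne_zero hc hj, by rw [bracket_subst, hb, hb', subst_C, map_mul]⟩

/-- The weighted degrees of `F` and `G` are `a δ` and `b δ`. -/
structure RatioAt (ρ σ δ : ℤ) (a b : ℕ) (F G : Poly) : Prop where
  jac : JacPair F G
  left : DegLE ρ σ (a * δ) F
  right : DegLE ρ σ (b * δ) G
  left_ne : part ρ σ (a * δ) F ≠ 0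
  right_ne : part ρ σ (b * δ) G ≠ 0

theorem RatioAt.subst (hr : RatioAt ρ σ δ a b F G) (h : IsHomAut ρ σ u v) :
    RatioAt ρ σ δ a b (subst u v F) (subst u v G) where
  jac := hr.jac.subst h.jac
  left := hr.left.subst h.left.degLE h.right.degLE
  right := hr.right.subst h.left.degLE h.right.degLE
  left_ne := by rw [part_subst hr.left h.left h.right]; exact h.ne_zero hr.left_ne
  right_ne := by rw [part_subst hr.right h.left h.right]; exact h.ne_zero hr.right_ne

theorem EdgeData.subst (hE : EdgeData ρ σ δ a b F G R H) (hr : RatioAt ρ σ δ a b F G)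
    (h : IsHomAut ρ σ u v) :
    EdgeData ρ σ δ a b (subst u v F) (subst u v G) (subst u v R) (subst u v H) where
  isHom := hE.isHom.subst h.left h.right
  ne_zero := h.ne_zero hE.ne_zero
  left := by rw [part_subst hr.left h.left h.right, hE.left, map_pow]
  right := by
    obtain ⟨c, hc, h1⟩ := hE.right
    exact ⟨c, hc, by rw [part_subst hr.right h.left h.right, h1, map_mul, map_pow, subst_C]⟩
  isHom' := hE.isHom'.subst h.left h.right
  bracket_eq := by
    obtain ⟨c, hc, h1⟩ := hE.bracket_eq
    obtain ⟨j, hj, h2⟩ := h.jac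
    refine ⟨c * j, mul_ne_zero hc hj, ?_⟩
    rw [bracket_subst, h1, h2, map_mul, subst_C, map_mul]
    ring
  dvd := by
    obtain ⟨N, hN⟩ := hE.dvd
    exact ⟨N, by rw [← map_pow]; exact map_dvd _ hN⟩

theorem Corner.ratioAt (hc : Corner a b p q F G) (hD : Dominates ρ σ a b p q F G) :
    RatioAt ρ σ (ρ * p + σ * q) a b F G :=
  ⟨hc.jac, hD.1, hD.2, hc.part_left_ne_zero ρ σ, hc.part_right_ne_zero ρ σ⟩

theorem EdgeData.corner {r : ℂ} (hE : EdgeData ρ σ δ a b F G (monomial (expo p q) r) H)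
    (hr : RatioAt ρ σ δ a b F G) :
    δ = ρ * p + σ * q ∧ Corner a b p q F G ∧ StrictlyDominates ρ σ a b p q F G := by
  have hr0 : r ≠ 0 := by rintro rfl; exact hE.ne_zero (by simp)
  have hδ : δ = ρ * p + σ * q := by
    rw [← wdeg_expo]
    exact hE.isHom.unique (isHom_monomial _ _ _ _) hE.ne_zero
  have he : ∀ n : ℕ, n • expo p q = expo (n * p) (n * q) := fun n => by
    rw [eq_expo_iff]; simp
  have hw : ∀ n : ℕ, wdeg ρ σ (expo (n * p) (n * q)) = n * δ := fun n => by
    rw [wdeg_corner, hδ]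
  have h1 := congrArg (coeff (expo (a * p) (a * q))) hE.left
  obtain ⟨c, hc, h2⟩ := hE.right
  replace h2 := congrArg (coeff (expo (b * p) (b * q))) h2
  rw [monomial_pow, he, coeff_part, if_pos (hw a), coeff_monomial, if_pos rfl] at h1
  rw [monomial_pow, he, C_mul_monomial, coeff_part, if_pos (hw b), coeff_monomial,
    if_pos rfl] at h2
  have hcorner : Corner a b p q F G :=
    ⟨hr.jac, by rw [h1]; exact pow_ne_zero _ hr0,
      by rw [h2]; exact mul_ne_zero hc (pow_ne_zero _ hr0)⟩
  refine ⟨hδ, hcorner, hE.strictlyDominates hcorner hδ ⟨?_, ?_⟩ ⟨_, _, rfl⟩⟩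
  · rw [← hδ]; exact hr.left
  · rw [← hδ]; exact hr.right

theorem isHomAut_shear (k : ℕ) {α : ℂ} (hα : α ≠ 0) (β : ℂ) :
    IsHomAut k 1 (C α * (X 0 - C β * X 1 ^ k)) (X 1) where
  left := by
    refine ((isHom_X0 _ _).sub (IsHom.C_mul ?_ β)).C_mul α
    simpa using (isHom_X1 k 1).pow k
  right := isHom_X1 _ _
  jac := by
    refine ⟨α, hα, ?_⟩
    simp only [bracket, pderiv_C_mul, map_sub, pderiv_pow, pderiv_X_self,
      pderiv_X_of_ne (show (0 : Fin 2) ≠ 1 by decide),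
      pderiv_X_of_ne (show (1 : Fin 2) ≠ 0 by decide)]
    ring
  inv := by
    refine ⟨JacobianTrapezoid.subst (C α⁻¹ * X 0 + C β * X 1 ^ k) (X 1), ?_, by simp⟩
    simp only [map_mul, map_sub, map_pow, subst_C, subst_X_zero, subst_X_one, add_sub_cancel_right]
    rw [← mul_assoc, ← map_mul, mul_inv_cancel₀ hα, map_one, one_mul]

theorem isHomAut_shear' (t : ℂ) : IsHomAut 1 1 (X 0) (X 1 + C t * X 0) where
  left := isHom_X0 _ _
  right := (isHom_X1 _ _).add ((isHom_X0 _ _).C_mul t)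
  jac := by
    refine ⟨1, one_ne_zero, ?_⟩
    simp only [bracket, pderiv_C_mul, map_add, pderiv_X_self,
      pderiv_X_of_ne (show (0 : Fin 2) ≠ 1 by decide),
      pderiv_X_of_ne (show (1 : Fin 2) ≠ 0 by decide), map_one]
    ring
  inv := by
    refine ⟨JacobianTrapezoid.subst (X 0) (X 1 - C t * X 0), by simp, ?_⟩
    simp only [map_add, map_mul, subst_C, subst_X_zero, subst_X_one]
    ring

theorem isHomAut_swap : IsHomAut 1 1 (X 1) (X 0) where
  left := isHom_X1 _ _
  right := isHom_X0 _ _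
  jac := by
    refine ⟨-1, by norm_num, ?_⟩
    simp only [bracket, pderiv_X_self, pderiv_X_of_ne (show (0 : Fin 2) ≠ 1 by decide),
      pderiv_X_of_ne (show (1 : Fin 2) ≠ 0 by decide), map_neg, map_one]
    ring
  inv := ⟨JacobianTrapezoid.subst (X 1) (X 0), by simp, by simp⟩

/-- A shear turns the leading parts into monomials. -/
theorem EdgeData.exists_shear {k : ℕ} (hE : EdgeData k 1 δ a b F G R H) {α β : ℂ}
    (hH : H = C α * (X 0 * X 1) + C β * X 1 ^ (k + 1)) :
    ∃ α' β' : ℂ, α' ≠ 0 ∧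
      ∃ i j r, JacobianTrapezoid.subst (C α' * (X 0 - C β' * X 1 ^ k)) (X 1) R = monomial (expo i j) r := by
  obtain ⟨N, hN⟩ := hE.dvd
  have key : ∀ (α' β' t : ℂ) (i j : ℕ), t ≠ 0 →
      JacobianTrapezoid.subst (C α' * (X 0 - C β' * X 1 ^ k)) (X 1) H = monomial (expo i j) t →
      ∃ i j r, JacobianTrapezoid.subst (C α' * (X 0 - C β' * X 1 ^ k)) (X 1) R =
        monomial (expo i j) r := by
    intro α' β' t i j ht h
    have h1 := map_dvd (JacobianTrapezoid.subst (C α' * (X 0 - C β' * X 1 ^ k)) (X 1)) hN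
    rw [map_pow, h] at h1
    obtain ⟨d, r, hd⟩ := exists_monomial_of_dvd_pow ht h1
    exact ⟨d 0, d 1, r, by rw [hd, ← (eq_expo_iff (d := d)).2 ⟨rfl, rfl⟩]⟩
  by_cases hα : α = 0
  · subst hα
    have hβ : β ≠ 0 := by rintro rfl; exact hE.ne_zero' (by rw [hH]; simp)
    refine ⟨1, 0, one_ne_zero, key 1 0 β 0 (k + 1) hβ ?_⟩
    rw [hH, monomial_expo]
    simp
  -- Since H = y(αx + βy^k), this shear sends H to xy.
  · refine ⟨α⁻¹, β, inv_ne_zero hα, key α⁻¹ β 1 1 1 one_ne_zero ?_⟩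
    rw [hH, monomial_expo]
    simp only [map_add, map_mul, map_pow, subst_C, subst_X_zero, subst_X_one]
    have h1 : (C α * C α⁻¹ : Poly) = 1 := by rw [← map_mul, mul_inv_cancel₀ hα, map_one]
    rw [map_one]
    linear_combination (X 0 - C β * X 1 ^ k) * X 1 * h1

theorem IsHom.eq_of_two_le {k : ℕ} (hk : 2 ≤ k) (hH : IsHom k 1 (k + 1) H) :
    H = C (coeff (expo 1 1) H) * (X 0 * X 1) + C (coeff (expo 0 (k + 1)) H) * X 1 ^ (k + 1) := by
  have e1 : (X 0 * X 1 : Poly) = monomial (expo 1 1) 1 := by rw [monomial_expo]; simp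
  have e2 : (X 1 ^ (k + 1) : Poly) = monomial (expo 0 (k + 1)) 1 := by rw [monomial_expo]; simp
  rw [e1, e2, C_mul_monomial, C_mul_monomial, mul_one, mul_one]
  ext d
  rw [coeff_add, coeff_monomial, coeff_monomial]
  have hne : expo 1 1 ≠ expo 0 (k + 1) := by
    intro h
    have := congrArg (fun d => d 0) h
    simp at this
  split_ifs with h1 h2 h2
  · exact absurd (h1.trans h2.symm) hne
  · rw [h1, add_zero]
  · rw [h2, zero_add]
  · rw [add_zero]
    by_contra hc
    have h3 := hH d (mem_support_iff.2 hc)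
    simp only [wdeg, one_mul] at h3
    have h3' : k * d 0 + d 1 = k + 1 := by exact_mod_cast h3
    have h4 : d 0 = 0 ∨ d 0 = 1 := by
      by_contra hne
      have : 2 ≤ d 0 := by omega
      nlinarith
    rcases h4 with h4 | h4
    · exact h2 (eq_expo_iff.2 ⟨h4, by rw [h4] at h3'; omega⟩).symm
    · exact h1 (eq_expo_iff.2 ⟨h4, by rw [h4] at h3'; omega⟩).symm

theorem IsHom.eq_quadratic (hH : IsHom 1 1 (1 + 1) H) :
    H = C (coeff (expo 2 0) H) * X 0 ^ 2 + C (coeff (expo 1 1) H) * (X 0 * X 1) +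
      C (coeff (expo 0 2) H) * X 1 ^ 2 := by
  have e0 : (X 0 ^ 2 : Poly) = monomial (expo 2 0) 1 := by rw [monomial_expo]; simp
  have e1 : (X 0 * X 1 : Poly) = monomial (expo 1 1) 1 := by rw [monomial_expo]; simp
  have e2 : (X 1 ^ 2 : Poly) = monomial (expo 0 2) 1 := by rw [monomial_expo]; simp
  rw [e0, e1, e2, C_mul_monomial, C_mul_monomial, C_mul_monomial, mul_one, mul_one, mul_one]
  ext d
  rw [coeff_add, coeff_add, coeff_monomial, coeff_monomial, coeff_monomial]
  have hex : ∀ i j : ℕ, expo i j = d ↔ d 0 = i ∧ d 1 = j := fun i j => by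
    rw [← eq_expo_iff, eq_comm]
  simp only [hex]
  by_cases hc : coeff d H = 0
  · have h1 : ∀ i j : ℕ, d 0 = i ∧ d 1 = j → coeff (expo i j) H = 0 := by
      intro i j h
      rw [← (hex i j).2 h] at hc
      exact hc
    rw [hc]
    split_ifs with h2 h3 h4 h5 h6 <;> simp_all
  · have h3 := hH d (mem_support_iff.2 hc)
    simp only [wdeg, one_mul] at h3
    have h3' : d 0 + d 1 = 2 := by omega
    have h4 : d 0 = 0 ∨ d 0 = 1 ∨ d 0 = 2 := by omega
    rcases h4 with h4 | h4 | h4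
    · have h5 : d 1 = 2 := by omega
      rw [(hex 0 2).2 ⟨h4, h5⟩]; simp [h4, h5]
    · have h5 : d 1 = 1 := by omega
      rw [(hex 1 1).2 ⟨h4, h5⟩]; simp [h4, h5]
    · have h5 : d 1 = 0 := by omega
      rw [(hex 2 0).2 ⟨h4, h5⟩]; simp [h4, h5]

/-- A binary quadratic form over ℂ has a zero, which a linear change moves so as to kill the x²
coefficient. This brings weight (1, 1) to the shape required by the shear. -/
theorem IsHom.exists_linear_aut (hH : IsHom 1 1 (1 + 1) H) :
    ∃ u v α β, IsHomAut 1 1 u v ∧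
      JacobianTrapezoid.subst u v H = C α * (X 0 * X 1) + C β * X 1 ^ (1 + 1) := by
  have h := hH.eq_quadratic
  set α₀ := coeff (expo 2 0) H
  set α₁ := coeff (expo 1 1) H
  set α₂ := coeff (expo 0 2) H
  by_cases h2 : α₂ = 0
  · refine ⟨X 1, X 0, α₁, α₀, isHomAut_swap, ?_⟩
    rw [h, h2]
    simp only [map_add, map_mul, map_pow, subst_C, subst_X_zero, subst_X_one, map_zero]
    ring
  · obtain ⟨s, hs⟩ := IsAlgClosed.exists_eq_mul_self (discrim α₂ α₁ α₀)
    obtain ⟨t, ht⟩ := exists_quadratic_eq_zero h2 ⟨s, hs⟩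
    refine ⟨X 0, X 1 + C t * X 0, α₁ + 2 * α₂ * t, α₂, isHomAut_shear' t, ?_⟩
    have ht' := congrArg (C : ℂ → Poly) ht
    simp only [map_add, map_mul, map_zero] at ht'
    rw [h]
    simp only [map_add, map_mul, map_pow, subst_C, subst_X_zero, subst_X_one]
    have h2' : (C 2 : Poly) = 2 := map_ofNat C 2
    rw [h2']
    linear_combination X 0 ^ 2 * ht'

end

/-! ### Extremal choice of the corner and normalisation -/

section

variable {ρ σ D E δ : ℤ} {f g P Q R H u v : Poly} {a b p q : ℕ} {F G : Poly}

theorem RatioAt.weight_le {k r : ℕ} (hr : RatioAt k 1 r a b F G) (hab : a ≤ b) : k ≤ b * r := by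
  have := hr.jac.le_mul hab (by positivity) (by norm_num) (by positivity) hr.left hr.right
  exact_mod_cast this

theorem RatioAt.exists_edgeData {k r : ℕ} (ha : 2 ≤ a) (hab : a < b) (hcop : Nat.Coprime a b)
    (hk : 1 ≤ k) (hr : RatioAt k 1 r a b F G) : ∃ R H, EdgeData k 1 r a b F G R H := by
  have h1 := hr.weight_le hab.le
  have h2 : 0 < r := Nat.pos_of_ne_zero fun h => by subst h; omega
  refine JacobianTrapezoid.exists_edgeData (by omega) (by omega) hcop hr.jac (by positivity)
    (by exact_mod_cast h2) ?_ hr.left hr.right hr.left_ne hr.right_ne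
  have : k + 1 < (a + b) * r := by nlinarith
  exact_mod_cast this

theorem RatioAt.exists_corner {k r : ℕ} (ha : 2 ≤ a) (hab : a < b) (hcop : Nat.Coprime a b)
    (hk : 1 ≤ k) (hr : RatioAt k 1 r a b F G) :
    ∃ F' G' p q, r = k * p + q ∧ Corner a b p q F' G' ∧ StrictlyDominates k 1 a b p q F' G' := by
  obtain ⟨R, H, hE⟩ := hr.exists_edgeData ha hab hcop hk
  have key : ∀ (F G R H : Poly) (α β : ℂ), RatioAt k 1 r a b F G → EdgeData k 1 r a b F G R H →
      H = C α * (X 0 * X 1) + C β * X 1 ^ (k + 1) →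
      ∃ F' G' p q, r = k * p + q ∧ Corner a b p q F' G' ∧
        StrictlyDominates k 1 a b p q F' G' := by
    intro F G R H α β hr hE hH
    obtain ⟨α', β', hα', i, j, t, hR⟩ := hE.exists_shear hH
    have hA := isHomAut_shear k hα' β'
    have hE' := hE.subst hr hA
    rw [hR] at hE'
    obtain ⟨h1, h2, h3⟩ := hE'.corner (hr.subst hA)
    exact ⟨_, _, i, j, by rw [one_mul] at h1; exact_mod_cast h1, h2, h3⟩
  rcases hk.lt_or_eq with hk2 | rfl
  · exact key F G R H _ _ hr hE (hE.isHom'.eq_of_two_le hk2)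
  · simp only [Nat.cast_one] at hr hE key
    obtain ⟨u, v, α, β, hA, hH⟩ := hE.isHom'.exists_linear_aut
    simpa using key _ _ _ _ α β (hr.subst hA) (hE.subst hr hA) hH

theorem StrictlyDominates.part_left_eq (hD : StrictlyDominates ρ σ a b p q F G) :
    ∃ c, part ρ σ (a * (ρ * p + σ * q)) F = monomial (expo (a * p) (a * q)) c := by
  refine ⟨_, eq_monomial_of_support fun d hd => ?_⟩
  have hw := isHom_part _ _ _ _ d hd
  rw [mem_support_iff, coeff_part, if_pos hw] at hd
  by_contra hne
  exact (hD.1 d (mem_support_iff.2 hd) hne).ne hw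

theorem EdgeData.eq_monomial (ha : 0 < a)
    (hD : StrictlyDominates ρ σ a b p q F G)
    (hE : EdgeData ρ σ (ρ * p + σ * q) a b F G R H) : ∃ r, R = monomial (expo p q) r := by
  obtain ⟨c, h1⟩ := hD.part_left_eq
  have hc0 : c ≠ 0 := by
    rintro rfl
    rw [hE.left, monomial_zero] at h1
    exact pow_ne_zero a hE.ne_zero h1
  have h2 : R ∣ monomial (expo (a * p) (a * q)) c := by
    rw [← h1, hE.left]; exact dvd_pow_self R ha.ne'
  obtain ⟨d, r, -, -, rfl⟩ := (dvd_monomial_iff_exists hc0).1 h2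
  refine ⟨r, ?_⟩
  rw [hE.left, monomial_pow, monomial_eq_monomial_iff] at h1
  rcases h1 with ⟨h1, -⟩ | ⟨-, h1⟩
  · have h3 : ∀ i, a * d i = a * expo p q i := by
      intro i
      have := DFunLike.congr_fun h1 i
      simp only [Finsupp.smul_apply, smul_eq_mul] at this
      rw [this]
      fin_cases i <;> simp
    rw [Finsupp.ext fun i => Nat.eq_of_mul_eq_mul_left ha (h3 i)]
  · exact absurd h1 hc0

theorem Corner.exists_edgeData_one_one (ha : 2 ≤ a) (hab : a < b) (hcop : Nat.Coprime a b)
    (hc : Corner a b p q F G) (hD : StrictlyDominates 1 1 a b p q F G) :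
    RatioAt 1 1 (1 * p + 1 * q) a b F G ∧
      ∃ r H, EdgeData 1 1 (1 * p + 1 * q) a b F G (monomial (expo p q) r) H := by
  have hr := hc.ratioAt hD.dominates
  obtain ⟨R, H, hE⟩ := RatioAt.exists_edgeData (k := 1) (r := p + q) ha hab hcop le_rfl
    (by simpa using hr)
  have hE' : EdgeData 1 1 (1 * p + 1 * q) a b F G R H := by simpa using hE
  obtain ⟨r, rfl⟩ := hE'.eq_monomial (by omega) hD
  exact ⟨hr, r, H, hE'⟩

theorem Corner.exists_swap (ha : 2 ≤ a) (hab : a < b) (hcop : Nat.Coprime a b)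
    (hc : Corner a b p q F G) (hD : StrictlyDominates 1 1 a b p q F G) :
    ∃ F' G', Corner a b q p F' G' ∧ StrictlyDominates 1 1 a b q p F' G' := by
  obtain ⟨hr, r, H, hE⟩ := hc.exists_edgeData_one_one ha hab hcop hD
  have h1 := hE.subst hr isHomAut_swap
  have h2 : subst (X 1) (X 0) (monomial (expo p q) r) = monomial (expo q p) r := by
    rw [subst_monomial, monomial_expo, expo_zero, expo_one, mul_comm (X 1 ^ p)]
  rw [h2] at h1
  obtain ⟨-, h3, h4⟩ := h1.corner (hr.subst isHomAut_swap)
  exact ⟨_, _, h3, h4⟩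

/-- If p = q, then R is a multiple of (xy)^p. Both variables divide the quadratic form H, so H is a
multiple of xy and [R, H] = 0, contradicting [R, H] = cR. -/
theorem Corner.ne (ha : 2 ≤ a) (hab : a < b) (hcop : Nat.Coprime a b) (hc : Corner a b p q F G)
    (hD : StrictlyDominates 1 1 a b p q F G) (hp : 0 < p) (hq : 0 < q) : p ≠ q := by
  rintro rfl
  obtain ⟨hr, r, H, hE⟩ := hc.exists_edgeData_one_one ha hab hcop hD
  have hd : ∀ i : Fin 2, ∀ d ∈ F.support, wdeg 1 1 d = a * (1 * p + 1 * p) → d i ≠ 0 := by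
    intro i d hd hw
    have h1 : d = expo (a * p) (a * p) := by
      by_contra hne
      exact (hD.1 d hd hne).ne hw
    have : a * p ≠ 0 := (mul_pos (by omega) hp).ne'
    rw [h1]
    fin_cases i <;> simpa using this
  have h0 := ne_zero_of_X_dvd (hE.X_dvd (hd 0))
  have h1 := ne_zero_of_X_dvd (hE.X_dvd (hd 1))
  have hH := eq_monomial_of_support (f := H) (e := expo 1 1) fun d hd => by
    have h2 := hE.isHom' d hd
    have h3 := h0 d hd
    have h4 := h1 d hd
    simp only [wdeg] at h2
    rw [eq_expo_iff]
    omega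
  obtain ⟨c, hc0, h2⟩ := hE.bracket_eq
  have h3 := X_mul_X_mul_bracket_monomial (expo p p) (expo 1 1) r (coeff (expo 1 1) H)
  rw [← hH, h2] at h3
  simp only [expo_zero, expo_one, Nat.cast_one, mul_one, one_mul, sub_self, map_zero,
    zero_mul] at h3
  exact mul_ne_zero (mul_ne_zero (X_ne_zero 0) (X_ne_zero 1))
    (mul_ne_zero (C_ne_zero.2 hc0) hE.ne_zero) h3

theorem RatioAt.exists_corner_one_one {r : ℕ} (ha : 2 ≤ a) (hab : a < b)
    (hcop : Nat.Coprime a b) (hr : RatioAt 1 1 r a b F G) :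
    ∃ F' G' p q, 0 < p ∧ p < q ∧ Corner a b p q F' G' ∧
      StrictlyDominates 1 1 a b p q F' G' := by
  classical
  have hex : ∃ r k : ℕ, 1 ≤ k ∧ ∃ F G, RatioAt k 1 r a b F G :=
    ⟨r, 1, le_rfl, F, G, by simpa using hr⟩
  obtain ⟨r, hr, hmin⟩ : ∃ r : ℕ, (∃ k : ℕ, 1 ≤ k ∧ ∃ F G, RatioAt k 1 r a b F G) ∧
      ∀ r' < r, ¬ ∃ k : ℕ, 1 ≤ k ∧ ∃ F G, RatioAt k 1 r' a b F G :=
    ⟨Nat.find hex, Nat.find_spec hex, fun r' h => Nat.find_min hex h⟩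
  -- With r minimal, k is taken maximal; such k are bounded by br.
  let S : Set ℕ := {k | 1 ≤ k ∧ ∃ F G, RatioAt k 1 r a b F G}
  have hS : BddAbove S := ⟨b * r, fun k ⟨_, F, G, h⟩ => h.weight_le hab.le⟩
  obtain ⟨hk, F₁, G₁, h1⟩ := Nat.sSup_mem (s := S) hr hS
  have hmax : ∀ k ∈ S, k ≤ sSup S := fun k hk => le_csSup hS hk
  set k := sSup S
  obtain ⟨F₂, G₂, p, q, hrpq, hc, hD⟩ := h1.exists_corner ha hab hcop hk
  have hr0 : 0 < r := by
    have := h1.weight_le hab.le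
    exact Nat.pos_of_ne_zero fun h => by subst h; omega
  -- a corner on the `y`-axis contradicts the choice of `k`
  have haxis : ∀ F G, Corner a b 0 r F G → ¬ StrictlyDominates k 1 a b 0 r F G := by
    intro F G hc hD
    have h2 := hc.ratioAt (hc.dominates_succ ha hab hcop hr0 (by exact_mod_cast hk) hD)
    have h3 := hmax (k + 1) ⟨by omega, F, G, by simpa using h2⟩
    omega
  have hp : 0 < p := by
    by_contra hp
    obtain rfl : p = 0 := by omega
    obtain rfl : r = q := by rw [hrpq]; ring
    exact haxis _ _ hc hD
  -- For k > 1, rotating to (k - 1, 1) would lower r = kp + q by p > 0.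
  have hk1 : k = 1 := by
    by_contra hne
    obtain ⟨l, hl⟩ : ∃ l, k = l + 1 := ⟨k - 1, by omega⟩
    rw [hl] at hD hrpq
    have h2 := hc.ratioAt (hc.dominates_pred (k := l) ha hab hcop hp (by omega)
      (by simpa using hD))
    refine hmin (l * p + q) ?_ ⟨l, by omega, F₂, G₂, by simpa using h2⟩
    rw [hrpq]
    nlinarith
  rw [hk1] at hD haxis hrpq
  simp only [Nat.cast_one] at hD haxis
  have hq : 0 < q := by
    by_contra hq
    obtain rfl : q = 0 := by omega
    obtain rfl : r = p := by rw [hrpq]; ring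
    obtain ⟨F', G', h2, h3⟩ := hc.exists_swap ha hab hcop hD
    exact haxis _ _ h2 h3
  rcases lt_or_gt_of_ne (hc.ne ha hab hcop hD hp hq) with h | h
  · exact ⟨F₂, G₂, p, q, hp, h, hc, hD⟩
  · obtain ⟨F', G', h2, h3⟩ := hc.exists_swap ha hab hcop hD
    exact ⟨F', G', q, p, hq, h, h2, h3⟩

theorem subst_shear_inverse (k : ℕ) {α : ℂ} (hα : α ≠ 0) (β : ℂ) (f : Poly) :
    subst (C α⁻¹ * X 0 + C β * X 1 ^ k) (X 1) (subst (C α * (X 0 - C β * X 1 ^ k)) (X 1) f) =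
      f := by
  have : (subst (C α⁻¹ * X 0 + C β * X 1 ^ k) (X 1)).comp
      (subst (C α * (X 0 - C β * X 1 ^ k)) (X 1)) = AlgHom.id ℂ Poly := by
    apply algHom_ext
    intro i
    fin_cases i
    · simp only [Fin.zero_eta, AlgHom.comp_apply, AlgHom.id_apply, map_mul, map_sub, map_pow,
        subst_C, subst_X_zero, subst_X_one, add_sub_cancel_right]
      rw [← mul_assoc, ← map_mul, mul_inv_cancel₀ hα, map_one, one_mul]
    · simp
  exact DFunLike.congr_fun this f

/-- A translation in `x` removes the horizontal edge. -/
theorem Corner.exists_strictlyDominates_zero_one (ha : 2 ≤ a) (hab : a < b)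
    (hcop : Nat.Coprime a b) (hc : Corner a b p q F G) (hp : 0 < p) (hpq : p < q)
    (h10 : Dominates 1 0 a b p q F G) (h01 : Dominates 0 1 a b p q F G) :
    ∃ F' G', Corner a b p q F' G' ∧ Dominates 1 0 a b p q F' G' ∧
      StrictlyDominates 0 1 a b p q F' G' := by
  have hr := hc.ratioAt h01
  obtain ⟨R, H, hE⟩ := exists_edgeData (ρ := 0) (σ := 1) (by omega) (by omega) hcop hc.jac
    (by norm_num) (by omega : (0 : ℤ) < 0 * p + 1 * q) (by
      have h1 : (2 : ℤ) ≤ a := by omega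
      have h2 : (3 : ℤ) ≤ b := by omega
      have h3 : (1 : ℤ) ≤ q := by omega
      nlinarith) h01.1 h01.2
    (hc.part_left_ne_zero 0 1) (hc.part_right_ne_zero 0 1)
  have hle := EdgeData.degree_zero_le_one (t := 0) (s := 1) (by omega) le_rfl one_pos
    (by simpa using hE) hc h10 hp hpq
  -- H has degree one in y and at most one in x, so H = y(αx + β). The shear with k = 0 is then an
  -- affine change of x alone.
  have hH : H = C (coeff (expo 1 1) H) * (X 0 * X 1) + C (coeff (expo 0 1) H) * X 1 ^ (0 + 1) := by
    have e1 : (X 0 * X 1 : Poly) = monomial (expo 1 1) 1 := by rw [monomial_expo]; simp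
    have e2 : (X 1 ^ (0 + 1) : Poly) = monomial (expo 0 1) 1 := by rw [monomial_expo]; simp
    rw [e1, e2, C_mul_monomial, C_mul_monomial, mul_one, mul_one]
    ext d
    rw [coeff_add, coeff_monomial, coeff_monomial]
    have hex : ∀ i j : ℕ, expo i j = d ↔ d 0 = i ∧ d 1 = j := fun i j => by
      rw [← eq_expo_iff, eq_comm]
    simp only [hex]
    by_cases hd : d 1 = 1 ∧ d 0 ≤ 1
    · rcases Nat.le_one_iff_eq_zero_or_eq_one.1 hd.2 with h | h
      · rw [(hex 0 1).2 ⟨h, hd.1⟩]; simp [h, hd.1]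
      · rw [(hex 1 1).2 ⟨h, hd.1⟩]; simp [h, hd.1]
    · rw [if_neg (by omega), if_neg (by omega), add_zero]
      by_contra hcd
      have h1 := hE.isHom' d (mem_support_iff.2 hcd)
      have h2 := hle d (mem_support_iff.2 hcd)
      simp only [wdeg] at h1
      omega
  have hE₀ : EdgeData (0 : ℕ) 1 (0 * p + 1 * q) a b F G R H := by simpa using hE
  obtain ⟨α, β, hα, i, j, t, hR⟩ := hE₀.exists_shear hH
  have hA := isHomAut_shear 0 hα β
  have hr₀ : RatioAt (0 : ℕ) 1 (0 * p + 1 * q) a b F G := by simpa using hr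
  have hE' := hE₀.subst hr₀ hA
  rw [hR] at hE'
  obtain ⟨hj, hc', hD'⟩ := hE'.corner (hr₀.subst hA)
  obtain rfl : q = j := by push_cast at hj; omega
  rw [Nat.cast_zero] at hD' hA
  have hu : DegLE 1 0 1 (C α * (X 0 - C β * X 1 ^ 0)) := by
    refine ((isHom_X0 1 0).degLE.sub ?_).C_mul α
    rw [pow_zero, mul_one]
    exact (isHom_C 1 0 β).degLE.mono (by norm_num)
  have hu' : DegLE 1 0 1 (C α⁻¹ * X 0 + C β * X 1 ^ 0) := by
    refine ((isHom_X0 1 0).degLE.C_mul _).add ?_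
    rw [pow_zero, mul_one]
    exact (isHom_C 1 0 β).degLE.mono (by norm_num)
  have hu'' : IsHom 0 1 0 (C α⁻¹ * X 0 + C β * X 1 ^ 0) := by
    refine ((isHom_X0 0 1).C_mul _).add ?_
    rw [pow_zero, mul_one]
    exact isHom_C 0 1 β
  have hv := (isHom_X1 1 0).degLE
  have hF' := h10.1.subst hu hv
  have hG' := h10.2.subst hu hv
  -- The affine change and its inverse both preserve the bound on the degree in x, so the new corner
  -- keeps its abscissa.
  have hi : i = p := by
    have ha0 : 0 < a := by omega
    apply le_antisymm
    · have h1 := hF' _ (mem_support_iff.2 hc'.left)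
      rw [wdeg_corner] at h1
      have h2 : a * i ≤ a * p := by zify; linarith
      exact Nat.le_of_mul_le_mul_left h2 ha0
    · obtain ⟨c, h1⟩ := hD'.part_left_eq
      have h2 := part_subst hD'.dominates.1 hu'' (isHom_X1 0 1)
      rw [subst_shear_inverse 0 hα β, h1] at h2
      have h3 := ((isHom_monomial 1 0 (expo (a * i) (a * q)) c).degLE).subst hu' hv
      rw [← h2] at h3
      have h4 := h3 (expo (a * p) (a * q)) (by
        rw [mem_support_iff, coeff_part, if_pos (by rw [wdeg_expo]; push_cast; ring)]
        exact hc.left)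
      rw [wdeg_expo, wdeg_expo] at h4
      have h5 : a * p ≤ a * i := by zify; push_cast at h4; linarith
      exact Nat.le_of_mul_le_mul_left h5 ha0
  subst hi
  exact ⟨_, _, hc', ⟨hF', hG'⟩, hD'⟩

/-- The Newton polygons can be put below the line of slope one and to the left of the vertical
line through the corner. -/
theorem RatioAt.exists_dominates {r : ℕ} (ha : 2 ≤ a) (hab : a < b)
    (hcop : Nat.Coprime a b) (hr : RatioAt 1 1 r a b F G) :
    ∃ F' G' p q, 0 < p ∧ p < q ∧ Corner a b p q F' G' ∧ Dominates 1 0 a b p q F' G' ∧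
      Dominates (-1) 1 a b p q F' G' := by
  obtain ⟨F₁, G₁, p, q, hp, hpq, hc, hD⟩ := hr.exists_corner_one_one ha hab hcop
  obtain ⟨F₂, G₂, hc', h10, h01⟩ := hc.exists_strictlyDominates_zero_one ha hab hcop hp hpq
    (hc.dominates_one_zero ha hab hcop hp hD) (hc.dominates_zero_one ha hab hcop (by omega) hD)
  exact ⟨F₂, G₂, p, q, hp, hpq, hc', h10,
    hc'.dominates_neg_one_one ha hab hcop hp hpq h10 h01⟩

end

/-! ### The trapezoid and the final substitution -/

section

variable {ρ σ D E δ : ℤ} {f g P Q R H u v : Poly} {a b p q m n : ℕ} {F G : Poly}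

theorem homComp_eq_part (u v k : ℕ) (f : Poly) : homComp u v k f = part u v k f := by
  classical
  ext d
  rw [homComp, coeff_weightedHomogeneousComponent, coeff_part, Finsupp.weight_apply,
    Finsupp.sum_fintype _ _ (by simp)]
  simp only [wdeg, Fin.sum_univ_two, Matrix.cons_val_zero, Matrix.cons_val_one, smul_eq_mul]
  congr 1
  rw [eq_iff_iff]
  constructor
  · intro h
    rw [← h]; push_cast; ring
  · intro h
    have : u * d 0 + v * d 1 = k := by exact_mod_cast h
    rw [← this]; ring

theorem DegLE.natCast_le (h : DegLE ρ σ D f) {d : Fin 2 →₀ ℕ} (hd : coeff d f ≠ 0) :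
    ρ * d 0 + σ * d 1 ≤ D := h d (mem_support_iff.2 hd)

theorem isHom_X_zero_add_one : IsHom 0 1 0 (X 0 + 1) :=
  (isHom_X0 0 1).add (by simpa using isHom_C 0 1 1)

theorem isHom_X_zero_add_X_one : IsHom 1 1 1 (X 0 + X 1) :=
  (isHom_X0 1 1).add (isHom_X1 1 1)

theorem degLE_X_zero_add_one : DegLE 1 σ 1 (X 0 + 1) :=
  (isHom_X0 1 σ).degLE.add
    ((show IsHom 1 σ 0 (1 : Poly) by simpa using isHom_C 1 σ 1).degLE.mono (by norm_num))

theorem degLE_X_zero_add_X_one : DegLE 0 1 1 (X 0 + X 1) :=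
  ((isHom_X0 0 1).degLE.mono (by norm_num)).add (isHom_X1 0 1).degLE

/-- A term (x + 1)^s (x + y)^t contributes to y-degree n - i only if t ≥ n - i, and then s ≥ t - (n
- m) ≥ m - i. -/
theorem dvd_homComp_zero_one (h : DegLE (-1) 1 (n - m) f) {i : ℕ} (him : i ≤ m) (hin : i ≤ n) :
    (X 0 + 1) ^ (m - i) ∣ homComp 0 1 (n - i) (subst (X 0 + 1) (X 0 + X 1) f) := by
  rw [homComp_eq_part, f.as_sum, map_sum, map_sum]
  refine Finset.dvd_sum fun d hd => ?_
  rw [subst_monomial, part_C_mul]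
  refine dvd_mul_of_dvd_right ?_ _
  have h1 := part_mul_of_isHom_left (isHom_X_zero_add_one.pow (d 0)) ((X 0 + X 1 : Poly) ^ d 1)
    ((n - i : ℕ) : ℤ)
  simp only [mul_zero, sub_zero] at h1
  simp only [Nat.cast_zero, Nat.cast_one]
  rw [h1]
  by_cases hlt : d 1 < n - i
  · rw [(degLE_X_zero_add_X_one.pow (d 1)).part_eq_zero (by omega), mul_zero]
    exact dvd_zero _
  · refine dvd_mul_of_dvd_left (pow_dvd_pow _ ?_) _
    have := h d hd
    simp only [wdeg] at this
    omega

/-- A term (x + 1)^s (x + y)^t has total degree s + t with s ≤ m, so reaching m + n - i requires t ≥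
n - i. -/
theorem dvd_homComp_one_one (h : DegLE 1 0 m f) {i : ℕ} (hin : i ≤ n) :
    (X 0 + X 1) ^ (n - i) ∣ homComp 1 1 (m + n - i) (subst (X 0 + 1) (X 0 + X 1) f) := by
  rw [homComp_eq_part, f.as_sum, map_sum, map_sum]
  refine Finset.dvd_sum fun d hd => ?_
  rw [subst_monomial, part_C_mul, mul_comm ((X 0 + 1 : Poly) ^ d 0)]
  refine dvd_mul_of_dvd_right ?_ _
  have h1 := part_mul_of_isHom_left (isHom_X_zero_add_X_one.pow (d 1)) ((X 0 + 1 : Poly) ^ d 0)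
    ((m + n - i : ℕ) : ℤ)
  simp only [mul_one] at h1
  simp only [Nat.cast_one]
  rw [h1]
  by_cases hlt : d 1 < n - i
  · have := h d hd
    simp only [wdeg] at this
    rw [((degLE_X_zero_add_one (σ := 1)).pow (d 0)).part_eq_zero (by omega), mul_zero]
    exact dvd_zero _
  · exact dvd_mul_of_dvd_left (pow_dvd_pow _ (by omega)) _

theorem coeff_eq_coeff_part (ρ σ : ℤ) (d : Fin 2 →₀ ℕ) (f : Poly) :
    coeff d f = coeff d (part ρ σ (wdeg ρ σ d) f) := by
  rw [coeff_part, if_pos rfl]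

theorem coeff_C_mul_expo (i j k l : ℕ) (c : ℂ) :
    coeff (expo i j) (C c * (X 0 ^ k * X 1 ^ l) : Poly) = if k = i ∧ l = j then c else 0 := by
  classical
  rw [← monomial_expo, coeff_monomial]
  congr 1
  rw [eq_expo_iff]
  simp

theorem part_zero_one_shear_pow :
    part 0 1 n ((X 0 + 1) ^ m * (X 0 + X 1) ^ n) = (X 0 + 1) ^ m * X 1 ^ n := by
  rw [part_mul_of_isHom_left (isHom_X_zero_add_one.pow m)]
  have h := part_pow degLE_X_zero_add_X_one n
  have h1 : part 0 1 1 (X 0 + X 1 : Poly) = X 1 := by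
    rw [map_add, (isHom_X1 0 1).part_eq, (isHom_X0 0 1).degLE.part_eq_zero (by norm_num), zero_add]
  rw [h1, mul_one] at h
  rw [← h]
  simp

theorem part_one_zero_add_one_pow :
    part 1 0 m ((X 0 + 1) ^ m) = X 0 ^ m := by
  have h := part_pow (degLE_X_zero_add_one (σ := 0)) m
  have h0 : IsHom 1 0 0 (1 : Poly) := by simpa using isHom_C 1 0 1
  have h1 : part 1 0 1 (X 0 + 1 : Poly) = X 0 := by
    rw [map_add, (isHom_X0 1 0).part_eq, h0.degLE.part_eq_zero (by norm_num), add_zero]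
  rw [h1, mul_one] at h
  exact h

theorem coeff_zero_top :
    coeff (expo 0 n) ((X 0 + 1) ^ m * (X 0 + X 1) ^ n : Poly) = 1 := by
  rw [coeff_eq_coeff_part 0 1, wdeg_expo]
  simp only [Nat.cast_zero, mul_zero, one_mul, zero_add]
  rw [part_zero_one_shear_pow, X_pow_eq_monomial]
  have e : expo 0 n = 0 + Finsupp.single 1 n := by simp [expo]
  rw [e, coeff_mul_monomial, mul_one, ← constantCoeff_eq]
  simp

theorem coeff_corner_top :
    coeff (expo m n) ((X 0 + 1) ^ m * (X 0 + X 1) ^ n : Poly) = 1 := by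
  rw [coeff_eq_coeff_part 0 1, wdeg_expo]
  simp only [zero_mul, one_mul, zero_add]
  rw [part_zero_one_shear_pow, coeff_eq_coeff_part 1 0, wdeg_expo]
  simp only [zero_mul, one_mul, add_zero]
  rw [mul_comm, part_mul_of_isHom_left ((isHom_X1 1 0).pow n)]
  simp only [mul_zero, sub_zero]
  rw [part_one_zero_add_one_pow, mul_comm, ← one_mul (X 0 ^ m * X 1 ^ n), ← C_1,
    coeff_C_mul_expo, if_pos ⟨rfl, rfl⟩]

theorem coeff_right_top :
    coeff (expo (m + n) 0) ((X 0 + 1) ^ m * (X 0 + X 1) ^ n : Poly) = 1 := by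
  rw [coeff_eq_coeff_part 1 0, wdeg_expo]
  have h1 := (degLE_X_zero_add_one (σ := 0)).pow m
  have h0 : DegLE 1 0 1 (X 0 + X 1 : Poly) :=
    (isHom_X0 1 0).degLE.add ((isHom_X1 1 0).degLE.mono (by norm_num))
  have h2 := part_pow h0 n
  have h3 : part 1 0 1 (X 0 + X 1 : Poly) = X 0 := by
    rw [map_add, (isHom_X0 1 0).part_eq, (isHom_X1 1 0).degLE.part_eq_zero (by norm_num), add_zero]
  have h4 := part_mul h1 (h0.pow n)
  rw [h2, h3] at h4
  simp only [mul_one] at h4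
  rw [part_one_zero_add_one_pow] at h4
  simp only [Nat.cast_add, one_mul, zero_mul, add_zero]
  rw [h4, ← pow_add, ← mul_one (X 0 ^ (m + n)), ← pow_zero (X 1 : Poly),
    ← one_mul (X 0 ^ (m + n) * X 1 ^ 0), ← C_1, coeff_C_mul_expo, if_pos ⟨rfl, rfl⟩]

section Trapezoid

theorem convex_trapezoid (m n : ℝ) : Convex ℝ (trapezoid m n) := by
  rintro ⟨x₁, y₁⟩ ⟨⟨h1, h2⟩, h3, h4⟩ ⟨x₂, y₂⟩ ⟨⟨k1, k2⟩, k3, k4⟩ s t hs ht hst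
  simp only at h1 h2 h3 h4 k1 k2 k3 k4
  have hs' : s = 1 - t := by linarith
  subst hs'
  refine ⟨⟨?_, ?_⟩, ?_, ?_⟩ <;>
    simp only [Prod.smul_mk, smul_eq_mul, Prod.mk_add_mk] <;> nlinarith

theorem trapezoid_subset {S : Set (ℝ × ℝ)} (hS : Convex ℝ S) {m n : ℝ} (hm : 0 < m) (hn : 0 < n)
    (h00 : (0, 0) ∈ S) (h1 : (0, n) ∈ S) (h2 : (m, n) ∈ S) (h3 : (m + n, 0) ∈ S) :
    trapezoid m n ⊆ S := by
  rintro ⟨x, y⟩ ⟨⟨hy0, hyn⟩, hx0, hx⟩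
  simp only at hy0 hyn hx0 hx
  have ht0 : 0 ≤ y / n := div_nonneg hy0 hn.le
  have ht1 : 0 ≤ 1 - y / n := by rw [sub_nonneg, div_le_one hn]; exact hyn
  have hL := hS h00 h1 ht1 ht0 (by ring)
  have hR := hS h3 h2 ht1 ht0 (by ring)
  simp only [Prod.smul_mk, smul_eq_mul, Prod.mk_add_mk, mul_zero, add_zero, zero_add,
    div_mul_cancel₀ _ hn.ne'] at hL hR
  have e : (1 - y / n) * (m + n) + y / n * m = m + n - y := by field_simp; ring
  rw [e] at hR
  have hw : 0 < m + n - y := by linarith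
  have hs0 : 0 ≤ x / (m + n - y) := div_nonneg hx0 hw.le
  have hs1 : 0 ≤ 1 - x / (m + n - y) := by rw [sub_nonneg, div_le_one hw]; exact hx
  have h := hS hL hR hs1 hs0 (by ring)
  simp only [Prod.smul_mk, smul_eq_mul, Prod.mk_add_mk, mul_zero, zero_add,
    div_mul_cancel₀ _ hw.ne'] at h
  convert h using 2
  ring

theorem mem_supp_of_coeff {i j : ℕ} (h : coeff (expo i j) f ≠ 0) : ((i : ℝ), (j : ℝ)) ∈ supp f :=
  ⟨_, mem_support_iff.2 h, by simp⟩

theorem newton0_eq_trapezoid (hm : 0 < m) (hn : 0 < n) (h01 : DegLE 0 1 n f)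
    (h11 : DegLE 1 1 (m + n) f) (h1 : coeff (expo 0 n) f ≠ 0) (h2 : coeff (expo m n) f ≠ 0)
    (h3 : coeff (expo (m + n) 0) f ≠ 0) : newton0 f = trapezoid m n := by
  have hf : f ≠ 0 := by rintro rfl; simp at h1
  rw [newton0, if_neg hf]
  apply Set.Subset.antisymm
  · refine convexHull_min ?_ (convex_trapezoid _ _)
    rintro x (⟨d, hd, rfl⟩ | rfl)
    · have e1 := h01 d hd
      have e2 := h11 d hd
      simp only [wdeg] at e1 e2
      have e1' : (d 1 : ℝ) ≤ n := by exact_mod_cast (by omega : d 1 ≤ n)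
      have e2' : (d 0 + d 1 : ℝ) ≤ m + n := by exact_mod_cast (by omega : d 0 + d 1 ≤ m + n)
      exact ⟨⟨Nat.cast_nonneg _, e1'⟩, Nat.cast_nonneg _, by simp only; linarith⟩
    · refine ⟨⟨le_rfl, Nat.cast_nonneg _⟩, le_rfl, ?_⟩
      simp only [sub_zero]; positivity
  · have hsub := subset_convexHull ℝ (supp f ∪ {((0 : ℝ), (0 : ℝ))})
    refine trapezoid_subset (convex_convexHull _ _) (by exact_mod_cast hm) (by exact_mod_cast hn)
      (hsub (Or.inr rfl)) (hsub (Or.inl ?_)) (hsub (Or.inl (mem_supp_of_coeff h2)))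
      (hsub (Or.inl ?_))
    · simpa using mem_supp_of_coeff h1
    · simpa using mem_supp_of_coeff h3

theorem newton0_sub_ssubset (hm : 0 < m) (h01 : DegLE 0 1 n f)
    (h11 : DegLE 1 1 (m + n) f) (h2 : coeff (expo m n) f = 1) :
    newton0 (f - X 0 ^ m * X 1 ^ n) ⊂ newton0 f := by
  classical
  have hf : f ≠ 0 := by rintro rfl; simp at h2
  have hcoeff : ∀ d, coeff d (f - X 0 ^ m * X 1 ^ n) = if d = expo m n then 0 else coeff d f := by
    intro d
    have e : (X 0 ^ m * X 1 ^ n : Poly) = monomial (expo m n) 1 := by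
      rw [monomial_expo, C_1, one_mul]
    rw [e, coeff_sub, coeff_monomial]
    split_ifs with h3 h4 h4
    · rw [← h3, h2, sub_self]
    · exact absurd h3.symm h4
    · exact absurd h4.symm h3
    · rw [sub_zero]
  set g := f - X 0 ^ m * X 1 ^ n with hg
  have hmem : ∀ d ∈ g.support, d ≠ expo m n ∧ d ∈ f.support := by
    intro d hd
    rw [mem_support_iff, hcoeff] at hd
    split_ifs at hd with h3
    · exact absurd rfl hd
    · exact ⟨h3, mem_support_iff.2 hd⟩
  have hsub : newton0 g ⊆ newton0 f := by
    unfold newton0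
    rw [if_neg hf]
    split_ifs
    · exact Set.empty_subset _
    · refine convexHull_mono (Set.union_subset_union_left _ ?_)
      rintro x ⟨d, hd, rfl⟩
      exact ⟨d, (hmem d hd).2, rfl⟩
  -- The functional x + 2y is the sum of y and x + y, so on the support it reaches m + 2n only at
  -- (m, n); removing that monomial costs at least one by integrality.
  have hhalf : newton0 g ⊆ {x | x.1 + 2 * x.2 ≤ m + 2 * n - 1} := by
    unfold newton0
    split_ifs
    · exact Set.empty_subset _
    · refine convexHull_min ?_ ?_
      · rintro x (⟨d, hd, rfl⟩ | rfl)
        · obtain ⟨h3, h4⟩ := hmem d hd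
          have e1 := h01 d h4
          have e2 := h11 d h4
          rw [Ne, eq_expo_iff] at h3
          simp only [wdeg] at e1 e2
          have e3 : d 0 + 2 * d 1 + 1 ≤ m + 2 * n := by omega
          have e4 : (d 0 + 2 * d 1 + 1 : ℝ) ≤ m + 2 * n := by exact_mod_cast e3
          simp only [Set.mem_ofPred_eq]
          linarith
        · have : (1 : ℝ) ≤ m := by exact_mod_cast hm
          have : (0 : ℝ) ≤ n := Nat.cast_nonneg n
          simp only [Set.mem_ofPred_eq]
          linarith
      · rintro ⟨x₁, y₁⟩ h1 ⟨x₂, y₂⟩ h2 s t hs ht hst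
        simp only [Set.mem_ofPred_eq, Prod.smul_mk, smul_eq_mul, Prod.mk_add_mk] at h1 h2 ⊢
        obtain rfl : s = 1 - t := by linarith
        nlinarith
  refine Set.ssubset_iff_subset_ne.2 ⟨hsub, fun heq => ?_⟩
  have hin : ((m : ℝ), (n : ℝ)) ∈ newton0 f := by
    rw [newton0, if_neg hf]
    exact subset_convexHull _ _ (Or.inl (mem_supp_of_coeff (by rw [h2]; exact one_ne_zero)))
  rw [← heq] at hin
  have := hhalf hin
  simp only [Set.mem_ofPred_eq] at this
  linarith

end Trapezoid

/-- The substitution `x ↦ x + 1`, `y ↦ x + y` produces the trapezoid. -/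
theorem newton0_subst (hm : 0 < m) (hmn : m < n) (h10 : DegLE 1 0 m f)
    (h11 : DegLE (-1) 1 (n - m) f) (hc : coeff (expo m n) f = 1) :
    newton0 (subst (X 0 + 1) (X 0 + X 1) f) = trapezoid m n ∧
      newton0 (subst (X 0 + 1) (X 0 + X 1) f - X 0 ^ m * X 1 ^ n) ⊂
        newton0 (subst (X 0 + 1) (X 0 + X 1) f) := by
  classical
  have hsum : DegLE 1 1 1 (X 0 + 1 : Poly) := degLE_X_zero_add_one
  have hF01 : DegLE 0 1 n f := by
    intro d hd
    have e1 := h10 d hd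
    have e2 := h11 d hd
    simp only [wdeg] at e1 e2 ⊢
    linarith
  have hF11 : DegLE 1 1 (m + n) f := by
    intro d hd
    have e1 := h10 d hd
    have e2 := h11 d hd
    simp only [wdeg] at e1 e2 ⊢
    linarith
  set W : Poly := (X 0 + 1) ^ m * (X 0 + X 1) ^ n with hW
  have hmono : subst (X 0 + 1) (X 0 + X 1) (monomial (expo m n) 1) = W := by
    rw [subst_monomial]; simp [hW]
  set g := f - monomial (expo m n) 1 with hg
  have hmem : ∀ d ∈ g.support, d ≠ expo m n ∧ d ∈ f.support := by
    intro d hd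
    rw [mem_support_iff, hg, coeff_sub, coeff_monomial] at hd
    split_ifs at hd with h3
    · rw [← h3, hc, sub_self] at hd; exact absurd rfl hd
    · rw [sub_zero] at hd; exact ⟨Ne.symm h3, mem_support_iff.2 hd⟩
  -- The bounds i ≤ m and j - i ≤ n - m make both j and i + j maximal only at (m, n). The other
  -- monomials therefore cannot reach the three nonzero vertices of the trapezoid.
  have hg01 : DegLE 0 1 (n - 1) g := by
    intro d hd
    obtain ⟨h3, h4⟩ := hmem d hd
    have e1 := h10 d h4
    have e2 := h11 d h4
    rw [Ne, eq_expo_iff] at h3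
    simp only [wdeg] at e1 e2 ⊢
    omega
  have hg11 : DegLE 1 1 (m + n - 1) g := by
    intro d hd
    obtain ⟨h3, h4⟩ := hmem d hd
    have e1 := h10 d h4
    have e2 := h11 d h4
    rw [Ne, eq_expo_iff] at h3
    simp only [wdeg] at e1 e2 ⊢
    omega
  have hTg01 := hg01.subst isHom_X_zero_add_one.degLE degLE_X_zero_add_X_one
  have hTg11 := hg11.subst hsum isHom_X_zero_add_X_one.degLE
  have hT : subst (X 0 + 1) (X 0 + X 1) f = subst (X 0 + 1) (X 0 + X 1) g + W := by
    rw [← hmono, ← map_add, hg, sub_add_cancel]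
  have key01 : ∀ i, coeff (expo i n) (subst (X 0 + 1) (X 0 + X 1) f) = coeff (expo i n) W := by
    intro i
    rw [hT, coeff_add, add_eq_right]
    by_contra hne
    have := hTg01.natCast_le hne
    simp only [expo_zero, expo_one] at this
    linarith
  have key11 : coeff (expo (m + n) 0) (subst (X 0 + 1) (X 0 + X 1) f) =
      coeff (expo (m + n) 0) W := by
    rw [hT, coeff_add, add_eq_right]
    by_contra hne
    have := hTg11.natCast_le hne
    simp only [expo_zero, expo_one] at this
    push_cast at this
    linarith
  have hT01 := hF01.subst isHom_X_zero_add_one.degLE degLE_X_zero_add_X_one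
  have hT11 := hF11.subst hsum isHom_X_zero_add_X_one.degLE
  have c1 := (key01 0).trans coeff_zero_top
  have c2 := (key01 m).trans coeff_corner_top
  have c3 := key11.trans coeff_right_top
  exact ⟨newton0_eq_trapezoid hm (by omega) hT01 hT11 (by rw [c1]; exact one_ne_zero)
    (by rw [c2]; exact one_ne_zero) (by rw [c3]; exact one_ne_zero),
    newton0_sub_ssubset hm hT01 hT11 c2⟩

theorem totalDegree_eq_sup_wdeg (hf : f ≠ 0) {r : ℕ} (hr : f.totalDegree = r) :
    DegLE 1 1 r f ∧ part 1 1 r f ≠ 0 := by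
  have key : ∀ d : Fin 2 →₀ ℕ, (d.sum fun _ e => e) = d 0 + d 1 := fun d => by
    rw [Finsupp.sum_fintype _ _ (by simp), Fin.sum_univ_two]
  constructor
  · intro d hd
    have := le_totalDegree hd
    rw [key, hr] at this
    simp only [wdeg]
    omega
  · obtain ⟨d, hd, h⟩ := f.support.exists_mem_eq_sup (support_nonempty.2 hf)
      (fun d => d.sum fun _ e => e)
    have h1 : d 0 + d 1 = r := by rw [← key, ← h, ← hr]; rfl
    intro h0
    have h2 := coeff_part 1 1 r f d
    rw [h0, if_pos (by simp only [wdeg]; omega), coeff_zero] at h2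
    exact mem_support_iff.1 hd h2.symm

theorem ratioAt_of_totalDegree (ha : 0 < a) (hab : Nat.Coprime a b)
    (hJ : JacPair F G) (hdeg : b * F.totalDegree = a * G.totalDegree) :
    ∃ r : ℕ, RatioAt 1 1 r a b F G := by
  have hne : bracket F G ≠ 0 := by
    obtain ⟨c, hc, h⟩ := hJ
    rw [h]; exact C_ne_zero.2 hc
  have hF : F ≠ 0 := by rintro rfl; simp [bracket] at hne
  have hG : G ≠ 0 := by rintro rfl; simp [bracket] at hne
  obtain ⟨r, hr⟩ : a ∣ F.totalDegree := hab.dvd_of_dvd_mul_left ⟨_, hdeg⟩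
  have hr' : G.totalDegree = b * r := by
    apply Nat.eq_of_mul_eq_mul_left ha
    rw [← hdeg, hr]; ring
  obtain ⟨h1, h2⟩ := totalDegree_eq_sup_wdeg hF hr
  obtain ⟨h3, h4⟩ := totalDegree_eq_sup_wdeg hG hr'
  push_cast at h1 h2 h3 h4
  exact ⟨r, hJ, h1, h3, h2, h4⟩

theorem JacPair.C_mul (hJ : JacPair F G) {s t : ℂ} (hs : s ≠ 0) (ht : t ≠ 0) :
    JacPair (C s * F) (C t * G) := by
  obtain ⟨c, hc, h⟩ := hJ
  refine ⟨s * (t * c), mul_ne_zero hs (mul_ne_zero ht hc), ?_⟩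
  rw [bracket_C_mul_left, bracket_C_mul_right, h, map_mul, map_mul]

theorem conjectureA_of_conjectureB : ConjectureB → ConjectureA := by
  intro hB a b ha hb hcop h2 hab F G hbr _ _ hdeg
  by_contra hne
  obtain ⟨c, hc⟩ := hbr
  have hJ : JacPair F G := ⟨c, by rintro rfl; exact hne (by rw [hc, C_0]), hc⟩
  obtain ⟨r, hr⟩ := ratioAt_of_totalDegree ha hcop hJ hdeg
  obtain ⟨F₀, G₀, p, q, hp, hpq, hcorner, h10, h11⟩ := hr.exists_dominates h2 hab hcop
  have hs := hcorner.left
  have ht := hcorner.right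
  set s := coeff (expo (a * p) (a * q)) F₀
  set t := coeff (expo (b * p) (b * q)) G₀
  -- Rescaling makes both corner coefficients 1, so that subtracting the corner monomial removes a
  -- vertex.
  have hJ' := hcorner.jac.C_mul (inv_ne_zero hs) (inv_ne_zero ht)
  have hJshift : JacPair (X 0 + 1) (X 0 + X 1) := ⟨1, one_ne_zero, by
    simp [bracket, pderiv_X_of_ne (show (0 : Fin 2) ≠ 1 by decide),
      pderiv_X_of_ne (show (1 : Fin 2) ≠ 0 by decide)]⟩
  obtain ⟨c', hc', hfinal⟩ := hJ'.subst hJshift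
  have hFm := newton0_subst (f := C s⁻¹ * F₀) (m := a * p) (n := a * q) (by positivity)
    (Nat.mul_lt_mul_of_pos_left hpq ha)
    (DegLE.C_mul (h10.1.mono (by push_cast; linarith)) _)
    (DegLE.C_mul (h11.1.mono (by push_cast; linarith)) _)
    (by rw [coeff_C_mul]; exact inv_mul_cancel₀ hs)
  have hGm := newton0_subst (f := C t⁻¹ * G₀) (m := b * p) (n := b * q) (by positivity)
    (Nat.mul_lt_mul_of_pos_left hpq hb)
    (DegLE.C_mul (h10.2.mono (by push_cast; linarith)) _)
    (DegLE.C_mul (h11.2.mono (by push_cast; linarith)) _)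
    (by rw [coeff_C_mul]; exact inv_mul_cancel₀ ht)
  have hdiv : ∀ k, b * (a * k) / a = b * k := fun k => by
    rw [show b * (a * k) = a * (b * k) by ring, Nat.mul_div_cancel_left _ ha]
  have hzero := hB a b (a * p) (a * q)
    ⟨ha, hb, by positivity, Nat.mul_pos ha (by omega), Nat.mul_lt_mul_of_pos_left hpq ha,
      dvd_mul_right _ _, dvd_mul_right _ _, hcop, h2, hab⟩
    (subst (X 0 + 1) (X 0 + X 1) (C s⁻¹ * F₀)) (subst (X 0 + 1) (X 0 + X 1) (C t⁻¹ * G₀))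
    hFm
    (fun i hi => dvd_homComp_zero_one
      (DegLE.C_mul (h11.1.mono (by push_cast; linarith)) _) hi
      (hi.trans (Nat.mul_le_mul_left a hpq.le)))
    (fun i hi => dvd_homComp_one_one (DegLE.C_mul (h10.1.mono (by push_cast; linarith)) _) hi)
    (by rw [hdiv, hdiv]; exact hGm) ⟨c', hfinal⟩
  rw [hfinal] at hzero
  exact hc' (C_eq_zero.1 hzero)

end

end JacobianTrapezoid

end

theorem mainTheorem3 :
    JacobianTrapezoid.ConjectureB → JacobianTrapezoid.ConjectureA :=
  JacobianTrapezoid.conjectureA_of_conjectureB
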